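/- All Banach spaces are real. Let $X$ and $Y_k$, $k\in\mathbb N$, be Banach spaces. For every $k$ let $\|\cdot\|_{X\oplus Y_k}$ be a norm on $X\oplus Y_k$ which coincides with $\|\cdot\|_X$ on $X$ and with $\|\cdot\|_{Y_k}$ on $Y_k$, and which is monotone, i.e. $\|x+y_k\|_{X\oplus Y_k}\ge\|x\|_X$ for all $x\in X$, $y_k\in Y_k$. Write $\|x^*+y_k^*\|_{X\oplus Y_k}$ for the dual norm of the functional $x+y_k\mapsto x^*(x)+y_k^*(y_k)$, where $x^*\in X^*$, $y_k^*\in Y_k^*$. The generalized $\ell^2$-sum $\Sigma(X\oplus Y_k)$ is the space of all formal sums $z=x+y_1+y_2+\cdots$ with $x\in X$, $y_k\in Y_k$ and $\sum_{k}\|y_k\|_{Y_k}^2<\infty$, equipped with the norm $$\|z\|_\Sigma=\sup\{|z^*(z)| : z^*\in\Lambda\},$$ where $\Lambda$ is the set of all functionals $z^*=x^*+\sum_{k}\alpha_k y_k^*$, that is, $z^*(x+y_1+y_2+\cdots)=x^*(x)+\sum_k\alpha_k y_k^*(y_k)$, with $x^*\in X^*$, $y_k^*\in Y_k^*$, $\|x^*+y_k^*\|_{X\oplus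 Y_k}\le 1$ and $0\le\alpha_k\le 1$ for every $k$, and $\sum_{k}\alpha_k^2\le 1$. A Banach space is called Fréchet smooth if its norm is Fréchet differentiable at every nonzero point. Suppose that the dual of $(X\oplus Y_k,\|\cdot\|_{X\oplus Y_k})$ is Fréchet smooth for every $k\in\mathbb N$, and that there is a constant $c>0$ such that $$\|x+y_k\|_{X\oplus Y_k}\ \ge\ \|x\|_X+c\,\|y_k\|_{Y_k},\qquad k\in\mathbb N,\ x\in X,\ y_k\in Y_k.$$ Then the dual of $\Sigma(X\oplus Y_k)$ (with the dual norm of $\|\cdot\|_\Sigma$) is Fréchet smooth. -/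

import Mathlib

open scoped ENNReal

noncomputable section

/-- A normed space is Fréchet smooth if its norm is Fréchet differentiable at every nonzero point. -/
def FrechetSmooth (E : Type*) [NormedAddCommGroup E] [NormedSpace ℝ E] : Prop :=
  ∀ e : E, e ≠ 0 → DifferentiableAt ℝ (fun v : E => ‖v‖) e

/-- A family of norms on the direct sums `X ⊕ Y k` which coincide with the given norms on the
summands and are monotone. (Definiteness of `nrm k` follows from the three conditions.) -/
structure SumNorms (X : Type*) [NormedAddCommGroup X] [NormedSpace ℝ X]
    (Y : ℕ → Type*) [∀ k, NormedAddCommGroup (Y k)] [∀ k, NormedSpace ℝ (Y k)] where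
  nrm : ∀ k, Seminorm ℝ (X × Y k)
  nrm_left : ∀ k (x : X), nrm k (x, 0) = ‖x‖
  nrm_right : ∀ k (y : Y k), nrm k (0, y) = ‖y‖
  nrm_mono : ∀ k (x : X) (y : Y k), ‖x‖ ≤ nrm k (x, y)

namespace SumNorms

variable {X : Type*} [NormedAddCommGroup X] [NormedSpace ℝ X]
  {Y : ℕ → Type*} [∀ k, NormedAddCommGroup (Y k)] [∀ k, NormedSpace ℝ (Y k)]

/-- The direct sum `X ⊕ Y k`, to be normed by `S.nrm k`. -/
def Pair (_S : SumNorms X Y) (k : ℕ) : Type _ := X × Y k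

instance (S : SumNorms X Y) (k : ℕ) : AddCommGroup (S.Pair k) :=
  inferInstanceAs (AddCommGroup (X × Y k))

instance (S : SumNorms X Y) (k : ℕ) : Module ℝ (S.Pair k) :=
  inferInstanceAs (Module ℝ (X × Y k))

instance (S : SumNorms X Y) (k : ℕ) : Norm (S.Pair k) := ⟨fun z => S.nrm k z⟩

theorem Pair.norm_def (S : SumNorms X Y) (k : ℕ) (z : S.Pair k) : ‖z‖ = S.nrm k z := rfl

theorem norm_snd_le (S : SumNorms X Y) (k : ℕ) (x : X) (y : Y k) :
    ‖y‖ ≤ 2 * S.nrm k (x, y) := by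
  have h : ((0 : X), y) = (x, y) + (-x, (0 : Y k)) := by simp
  have h1 := map_add_le_add (S.nrm k) (x, y) (-x, (0 : Y k))
  rw [← h, S.nrm_right, S.nrm_left, norm_neg] at h1
  linarith [S.nrm_mono k x y]

theorem Pair.core (S : SumNorms X Y) (k : ℕ) : NormedSpace.Core ℝ (S.Pair k) where
  norm_nonneg z := apply_nonneg (S.nrm k) z
  norm_smul c z := map_smul_eq_mul (S.nrm k) c z
  norm_triangle z w := map_add_le_add (S.nrm k) z w
  norm_eq_zero_iff z := by
    constructor
    · intro h
      obtain ⟨x, y⟩ := z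
      have h0 : S.nrm k (x, y) = 0 := h
      have h1 := S.nrm_mono k x y
      have h2 := S.norm_snd_le k x y
      rw [h0] at h1 h2
      have hx : x = 0 := norm_le_zero_iff.1 h1
      have hy : y = 0 := norm_le_zero_iff.1 (by simpa using h2)
      subst hx hy
      rfl
    · rintro rfl
      exact map_zero (S.nrm k)

instance (S : SumNorms X Y) (k : ℕ) : NormedAddCommGroup (S.Pair k) :=
  NormedAddCommGroup.ofCore (Pair.core S k)

instance (S : SumNorms X Y) (k : ℕ) : NormedSpace ℝ (S.Pair k) :=
  NormedSpace.ofCore (Pair.core S k)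

/-- The projection of `X ⊕ Y k` onto `X`. -/
def Pair.fst (S : SumNorms X Y) (k : ℕ) : S.Pair k →L[ℝ] X :=
  LinearMap.mkContinuous (LinearMap.fst ℝ X (Y k) : S.Pair k →ₗ[ℝ] X) 1
    (fun z => by rw [one_mul]; exact S.nrm_mono k z.1 z.2)

/-- The projection of `X ⊕ Y k` onto `Y k`. -/
def Pair.snd (S : SumNorms X Y) (k : ℕ) : S.Pair k →L[ℝ] Y k :=
  LinearMap.mkContinuous (LinearMap.snd ℝ X (Y k) : S.Pair k →ₗ[ℝ] Y k) 2
    (fun z => S.norm_snd_le k z.1 z.2)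

/-- The functional `x* + y*` on `X ⊕ Y k`, `(x* + y*) (x + y) = x* x + y* y`. -/
def Pair.functional (S : SumNorms X Y) (k : ℕ) (f : StrongDual ℝ X) (g : StrongDual ℝ (Y k)) :
    StrongDual ℝ (S.Pair k) :=
  f.comp (Pair.fst S k) + g.comp (Pair.snd S k)

theorem Pair.functional_apply (S : SumNorms X Y) (k : ℕ) (f : StrongDual ℝ X)
    (g : StrongDual ℝ (Y k)) (z : S.Pair k) : Pair.functional S k f g z = f z.1 + g z.2 := rfl

/-- The underlying vector space of the generalized `ℓ²`-sum: all `x + y₀ + y₁ + ⋯` with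
`∑ ‖y k‖ ^ 2 < ∞`. -/
def Sigma (_S : SumNorms X Y) : Type _ := X × lp Y 2

instance (S : SumNorms X Y) : AddCommGroup S.Sigma :=
  inferInstanceAs (AddCommGroup (X × lp Y 2))

instance (S : SumNorms X Y) : Module ℝ S.Sigma :=
  inferInstanceAs (Module ℝ (X × lp Y 2))

/-- The set of all functionals `x* + ∑ k, α k • y* k` where `‖x* + y* k‖ ≤ 1` on `X ⊕ Y k`,
`0 ≤ α k ≤ 1` and `∑ k, α k ^ 2 ≤ 1`. (The series `∑ k, α k * y* k (y k)` then always converges.) -/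
def Lam (S : SumNorms X Y) : Set (S.Sigma →ₗ[ℝ] ℝ) :=
  {φ | ∃ (f : StrongDual ℝ X) (g : ∀ k, StrongDual ℝ (Y k)) (α : ℕ → ℝ),
    (∀ k, ‖Pair.functional S k f (g k)‖ ≤ 1) ∧
    (∀ k, 0 ≤ α k ∧ α k ≤ 1) ∧
    (Summable (fun k => α k ^ 2) ∧ ∑' k, α k ^ 2 ≤ 1) ∧
    ∀ z : S.Sigma, HasSum (fun k => α k * g k (z.2 k)) (φ z - f z.1)}

/-- `‖z‖ = sup {|φ z| : φ ∈ Λ}`. -/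
instance (S : SumNorms X Y) : Norm S.Sigma := ⟨fun z => sSup {r : ℝ | ∃ φ ∈ S.Lam, r = |φ z|}⟩

theorem Sigma.norm_def (S : SumNorms X Y) (z : S.Sigma) :
    ‖z‖ = sSup {r : ℝ | ∃ φ ∈ S.Lam, r = |φ z|} := rfl

theorem abs_left_le (S : SumNorms X Y) (k : ℕ) {f : StrongDual ℝ X} {g : StrongDual ℝ (Y k)}
    (h : ‖Pair.functional S k f g‖ ≤ 1) (x : X) : |f x| ≤ ‖x‖ := by
  have h1 := (Pair.functional S k f g).le_of_opNorm_le h (show S.Pair k from (x, 0))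
  rw [Pair.functional_apply, Pair.norm_def] at h1
  change ‖f x + g 0‖ ≤ 1 * S.nrm k (x, 0) at h1
  rw [S.nrm_left, one_mul] at h1
  simpa using h1

theorem abs_right_le (S : SumNorms X Y) (k : ℕ) {f : StrongDual ℝ X} {g : StrongDual ℝ (Y k)}
    (h : ‖Pair.functional S k f g‖ ≤ 1) (y : Y k) : |g y| ≤ ‖y‖ := by
  have h1 := (Pair.functional S k f g).le_of_opNorm_le h (show S.Pair k from (0, y))
  rw [Pair.functional_apply, Pair.norm_def] at h1
  change ‖f 0 + g y‖ ≤ 1 * S.nrm k (0, y) at h1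
  rw [S.nrm_right, one_mul] at h1
  simpa using h1

theorem Sigma.summable_sq (S : SumNorms X Y) (z : S.Sigma) :
    Summable (fun k => ‖z.2 k‖ ^ 2) := by
  have h := (lp.memℓp z.2).summable (by norm_num)
  simpa using h

theorem Sigma.bddAbove (S : SumNorms X Y) (z : S.Sigma) :
    BddAbove {r : ℝ | ∃ φ ∈ S.Lam, r = |φ z|} := by
  refine ⟨‖z.1‖ + (1 + ∑' k, ‖z.2 k‖ ^ 2), ?_⟩
  rintro r ⟨φ, ⟨f, g, α, h1, h2, ⟨h3, h4⟩, h5⟩, rfl⟩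
  have hz := Sigma.summable_sq S z
  have hb : ∀ k, ‖α k * g k (z.2 k)‖ ≤ α k ^ 2 + ‖z.2 k‖ ^ 2 := by
    intro k
    rw [norm_mul, Real.norm_eq_abs, Real.norm_eq_abs, abs_of_nonneg (h2 k).1]
    have := mul_le_mul_of_nonneg_left (S.abs_right_le k (h1 k) (z.2 k)) (h2 k).1
    nlinarith [sq_nonneg (α k - ‖z.2 k‖), sq_nonneg (α k), sq_nonneg ‖z.2 k‖]
  have h6 := tsum_of_norm_bounded (h3.add hz).hasSum hb
  rw [(h5 z).tsum_eq, h3.tsum_add hz, Real.norm_eq_abs] at h6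
  have h7 := S.abs_left_le 0 (h1 0) z.1
  have h8 : |φ z| ≤ |φ z - f z.1| + |f z.1| := by
    simpa using abs_add_le (φ z - f z.1) (f z.1)
  linarith

theorem Sigma.le_norm (S : SumNorms X Y) (z : S.Sigma) {φ : S.Sigma →ₗ[ℝ] ℝ} (h : φ ∈ S.Lam) :
    |φ z| ≤ ‖z‖ :=
  le_csSup (Sigma.bddAbove S z) ⟨φ, h, rfl⟩

theorem zero_mem_Lam (S : SumNorms X Y) : (0 : S.Sigma →ₗ[ℝ] ℝ) ∈ S.Lam := by
  refine ⟨0, 0, 0, fun k => ?_, by simp, by simp, fun z => by simp [hasSum_zero]⟩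
  have : Pair.functional S k 0 ((0 : ∀ k, StrongDual ℝ (Y k)) k) = 0 := by
    ext z; simp [Pair.functional_apply]
  rw [this, norm_zero]
  exact zero_le_one

theorem Sigma.norm_le (S : SumNorms X Y) (z : S.Sigma) {a : ℝ}
    (h : ∀ φ ∈ S.Lam, |φ z| ≤ a) : ‖z‖ ≤ a := by
  refine csSup_le ⟨_, 0, S.zero_mem_Lam, rfl⟩ ?_
  rintro r ⟨φ, hφ, rfl⟩
  exact h φ hφ

theorem Sigma.norm_fst_le (S : SumNorms X Y) (z : S.Sigma) : ‖z.1‖ ≤ ‖z‖ := by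
  obtain ⟨f, hf, hfz⟩ := exists_dual_vector'' ℝ z.1
  let φ : S.Sigma →ₗ[ℝ] ℝ := f.toLinearMap.comp (LinearMap.fst ℝ X (lp Y 2))
  have hφ : φ ∈ S.Lam := by
    refine ⟨f, 0, 0, fun k => ?_, by simp, by simp, fun z => ?_⟩
    · refine ContinuousLinearMap.opNorm_le_bound _ zero_le_one fun w => ?_
      have h1 := f.le_of_opNorm_le hf w.1
      have h2 := S.nrm_mono k w.1 w.2
      rw [Pair.functional_apply, Pair.norm_def]
      simp only [Pi.zero_apply, zero_apply, add_zero]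
      exact h1.trans (mul_le_mul_of_nonneg_left h2 zero_le_one)
    · have : φ z - f z.1 = 0 := sub_self _
      rw [this]
      simp [hasSum_zero]
  have h := Sigma.le_norm S z hφ
  have h' : φ z = ‖z.1‖ := hfz
  rwa [h', abs_of_nonneg (norm_nonneg _)] at h

theorem Sigma.norm_snd_le (S : SumNorms X Y) (z : S.Sigma) (j : ℕ) : ‖z.2 j‖ ≤ 2 * ‖z‖ := by
  obtain ⟨f, hf, hfz⟩ := exists_dual_vector'' ℝ (z.2 j)
  let φ : S.Sigma →ₗ[ℝ] ℝ :=
    { toFun := fun w => (1 / 2 : ℝ) * f (w.2 j)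
      map_add' := fun v w => by
        change (1 / 2 : ℝ) * f (v.2 j + w.2 j) = _
        rw [map_add, mul_add]
      map_smul' := fun c w => by
        change (1 / 2 : ℝ) * f (c • w.2 j) = _
        rw [map_smul, smul_eq_mul, smul_eq_mul, RingHom.id_apply]
        ring }
  have hφ : φ ∈ S.Lam := by
    refine ⟨0, Pi.single j ((1 / 2 : ℝ) • f), Pi.single j 1, fun k => ?_, fun k => ?_, ?_,
      fun w => ?_⟩
    · refine ContinuousLinearMap.opNorm_le_bound _ zero_le_one fun w => ?_
      rw [Pair.functional_apply, Pair.norm_def, one_mul]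
      by_cases hk : k = j
      · subst hk
        have h1 := f.le_of_opNorm_le hf w.2
        have h2 := S.norm_snd_le k w.1 w.2
        rw [Pi.single_eq_same, zero_apply, zero_add,
          smul_apply, norm_smul]
        have h3 : ‖(1 / 2 : ℝ)‖ = 1 / 2 := by norm_num
        rw [h3]
        change _ ≤ S.nrm k (w.1, w.2)
        linarith
      · rw [Pi.single_eq_of_ne hk]
        rw [zero_apply, zero_apply, add_zero, norm_zero]
        exact apply_nonneg (S.nrm k) w
    · by_cases hk : k = j
      · subst hk; simp
      · simp [Pi.single_eq_of_ne hk]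
    · have h : HasSum (fun k => (Pi.single j (1 : ℝ) : ℕ → ℝ) k ^ 2) 1 := by
        have h0 := hasSum_single (f := fun k => (Pi.single j (1 : ℝ) : ℕ → ℝ) k ^ 2) j
          (fun k hk => by simp [Pi.single_eq_of_ne hk])
        simpa using h0
      exact ⟨h.summable, h.tsum_eq.le⟩
    · have h0 := hasSum_single (f := fun k => (Pi.single j (1 : ℝ) : ℕ → ℝ) k *
        (Pi.single j ((1 / 2 : ℝ) • f) : ∀ k, StrongDual ℝ (Y k)) k (w.2 k)) j
          (fun k hk => by simp [Pi.single_eq_of_ne hk])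
      convert h0 using 1
      simp only [Pi.single_eq_same, one_mul, smul_apply, smul_eq_mul,
        zero_apply, sub_zero]
      rfl
  have h := Sigma.le_norm S z hφ
  have h' : φ z = (1 / 2 : ℝ) * ‖z.2 j‖ := by
    change (1 / 2 : ℝ) * f (z.2 j) = _
    rw [hfz]
    rfl
  rw [h', abs_of_nonneg (by positivity)] at h
  linarith

theorem Sigma.core (S : SumNorms X Y) : NormedSpace.Core ℝ S.Sigma where
  norm_nonneg z := (abs_nonneg _).trans (Sigma.le_norm S z S.zero_mem_Lam)
  norm_smul c z := by
    have key : ∀ (a : ℝ) (w : S.Sigma), ‖a • w‖ ≤ ‖a‖ * ‖w‖ := fun a w =>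
      Sigma.norm_le S _ fun φ hφ => by
        rw [map_smul, smul_eq_mul, abs_mul, Real.norm_eq_abs]
        exact mul_le_mul_of_nonneg_left (Sigma.le_norm S w hφ) (abs_nonneg a)
    refine le_antisymm (key c z) ?_
    by_cases hc : c = 0
    · subst hc
      rw [norm_zero, zero_mul]
      exact (abs_nonneg _).trans (Sigma.le_norm S _ S.zero_mem_Lam)
    · have h := key c⁻¹ (c • z)
      rw [inv_smul_smul₀ hc, norm_inv] at h
      have hc' : 0 < ‖c‖ := norm_pos_iff.2 hc
      rwa [inv_mul_eq_div, le_div_iff₀ hc', mul_comm] at h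
  norm_triangle z w := Sigma.norm_le S _ fun φ hφ => by
    rw [map_add]
    exact (abs_add_le _ _).trans (add_le_add (Sigma.le_norm S z hφ) (Sigma.le_norm S w hφ))
  norm_eq_zero_iff z := by
    constructor
    · intro h
      have h1 := Sigma.norm_fst_le S z
      rw [h] at h1
      have hx : z.1 = 0 := norm_le_zero_iff.1 h1
      have hy : z.2 = 0 := by
        ext j
        have h2 := Sigma.norm_snd_le S z j
        rw [h, mul_zero] at h2
        exact norm_le_zero_iff.1 h2
      exact Prod.ext hx hy
    · rintro rfl
      refine le_antisymm (Sigma.norm_le S _ fun φ _ => ?_)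
        ((abs_nonneg _).trans (Sigma.le_norm S _ S.zero_mem_Lam))
      rw [map_zero, abs_zero]

instance (S : SumNorms X Y) : NormedAddCommGroup S.Sigma :=
  NormedAddCommGroup.ofCore (Sigma.core S)

instance (S : SumNorms X Y) : NormedSpace ℝ S.Sigma :=
  NormedSpace.ofCore (Sigma.core S)

end SumNorms

end

/-!
The dual norm of a reflexive space is Fréchet differentiable as soon as the space is strictly convex
and has the Kadec–Klee property: the points at which a functional is almost normed then converge in
norm, and Šmulian's criterion applies.

A space with Fréchet smooth dual is reflexive: given `Φ` in the bidual, the derivative of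
`f ↦ ‖f‖ ^ 2 - Φ f` comes within `ε` of zero by a variational principle, and by smoothness the
derivative of `‖f‖ ^ 2` is evaluation at a point of the space. The lower estimate makes the
generalized sum isomorphic to the `ℓ²`-sum of `X` and the `Y k`, so that it is reflexive too.

Strict convexity and the Kadec–Klee property both rest on perturbing a functional
`φ = f + ∑ k, α k • g k` of `Λ` that almost norms a point `w`. Let `f + g k` move in a direction
tangent to the dual unit ball of `X ⊕ Y k`. This leaves the ball only to second order, so the
perturbed functional cannot exceed the norm of `w` to first order, and hence the direction almost
vanishes on `w`. By smoothness, the tangent directions at `f + g k` are the functionals vanishing at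
its norming point. This determines the coordinates of `w`, up to a common factor in strict
convexity and along weakly convergent filters in the Kadec–Klee property. If `‖f‖ = 1`, then `f`
itself norms the points considered, and the lower estimate leaves no room for the `Y k`; it also
controls the tails of `w`.
-/

open Filter Topology Metric Set NormedSpace

/-! ### Points where a functional is almost normed -/

section VariationalPrinciple

theorem exists_mem_forall_le_add {M : Type*} {F : M → ℝ} {T : Set M} (hT : T.Nonempty)
    (hbdd : BddBelow (F '' T)) {δ : ℝ} (hδ : 0 < δ) : ∃ v ∈ T, ∀ x ∈ T, F v ≤ F x + δ := by
  obtain ⟨_, ⟨v, hv, rfl⟩, hlt⟩ :=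
    exists_lt_of_csInf_lt (hT.image F) (lt_add_of_pos_right (sInf (F '' T)) hδ)
  exact ⟨v, hv, fun x hx => by linarith [csInf_le hbdd (mem_image_of_mem F hx)]⟩

theorem nonempty_iInter_of_subset_closedBall {M : Type*} [PseudoMetricSpace M] [CompleteSpace M]
    {C : ℕ → Set M} {u : ℕ → M} {r : ℕ → ℝ} (closed : ∀ n, IsClosed (C n)) (anti : Antitone C)
    (mem : ∀ n, u n ∈ C n) (subset : ∀ n, C n ⊆ closedBall (u n) (r n))
    (hr : Tendsto r atTop (𝓝 0)) : (⋂ n, C n).Nonempty := by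
  have r_nonneg (n : ℕ) : 0 ≤ r n := nonempty_closedBall.1 ⟨u n, subset n (mem n)⟩
  have diam_le (n : ℕ) : diam (C n) ≤ 2 * r n :=
    (diam_mono (subset n) isBounded_closedBall).trans (diam_closedBall (r_nonneg n))
  exact nonempty_iInter_of_nonempty_biInter closed
    (fun n => isBounded_closedBall.subset (subset n))
    (fun N => ⟨u N, mem_iInter₂.2 fun n hn => anti hn (mem N)⟩)
    (squeeze_zero (fun _ => diam_nonneg) diam_le (by simpa using hr.const_mul 2))

/-- A weak form of Ekeland's variational principle. -/
theorem exists_forall_le_add_mul_dist {M : Type*} [PseudoMetricSpace M] [CompleteSpace M]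
    [Nonempty M] {F : M → ℝ} (hF : LowerSemicontinuous F) (hbdd : BddBelow (range F))
    {ε : ℝ} (hε : 0 < ε) : ∃ x₀, ∀ x, F x₀ ≤ F x + ε * dist x x₀ := by
  let T : M → Set M := fun y => {x | F x + ε * dist x y ≤ F y}
  have isClosed_T (y : M) : IsClosed (T y) := by
    have hlsc : LowerSemicontinuous fun x => F x + ε * dist x y :=
      hF.add (by fun_prop : Continuous fun x => ε * dist x y).lowerSemicontinuous
    exact hlsc.isClosed_preimage (F y)
  have mem_self (y : M) : y ∈ T y := by simp [T]
  have T_subset {x y : M} (hxy : x ∈ T y) : T x ⊆ T y := fun v hv => by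
    simp only [T, mem_ofPred_eq] at hxy hv ⊢
    linarith [mul_le_mul_of_nonneg_left (dist_triangle v x y) hε.le]
  have exists_almost_min (n : ℕ) (y : M) : ∃ v ∈ T y, ∀ x ∈ T y, F v ≤ F x + (1 / 2) ^ n :=
    exists_mem_forall_le_add ⟨y, mem_self y⟩ (hbdd.mono (image_subset_range F _)) (by positivity)
  choose v v_mem v_min using exists_almost_min
  let u : ℕ → M := Nat.rec (Classical.arbitrary M) v
  have anti : Antitone fun n => T (u n) := antitone_nat_of_succ_le fun n => T_subset (v_mem n (u n))
  have subset_ball (n : ℕ) : T (u (n + 1)) ⊆ closedBall (u (n + 1)) ((1 / 2) ^ n / ε) :=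
    fun x hx => by
      rw [mem_closedBall, le_div_iff₀ hε]
      have h := v_min n (u n) x (anti n.le_succ hx)
      simp only [T, mem_ofPred_eq] at hx
      linarith!
  have tendsto_half : Tendsto (fun n : ℕ => (1 / 2 : ℝ) ^ n) atTop (𝓝 0) :=
    tendsto_pow_atTop_nhds_zero_of_lt_one (by norm_num) (by norm_num)
  obtain ⟨x₀, hx₀⟩ := nonempty_iInter_of_subset_closedBall (fun n => isClosed_T (u (n + 1)))
    (anti.comp_monotone fun _ _ h => Nat.succ_le_succ h) (fun _ => mem_self _) subset_ball
    (by simpa using tendsto_half.div_const ε)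
  rw [mem_iInter] at hx₀
  refine ⟨x₀, fun x => ?_⟩
  by_contra! hx
  have le_add (n : ℕ) : F x₀ ≤ F x + (1 / 2) ^ n := by
    have h := v_min n (u n) x (anti n.le_succ (T_subset (hx₀ n) hx.le))
    have h₀ := hx₀ n
    simp only [T, mem_ofPred_eq] at h₀
    have := mul_nonneg hε.le (dist_nonneg (x := x₀) (y := u (n + 1)))
    linarith!
  have : F x₀ ≤ F x := by
    simpa using ge_of_tendsto' (tendsto_half.const_add (F x)) le_add
  linarith [mul_nonneg hε.le (dist_nonneg (x := x) (y := x₀))]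

end VariationalPrinciple

section Smulian

variable {E : Type*} [NormedAddCommGroup E] [NormedSpace ℝ E]

theorem norm_le_of_forall_sphere_le {D : StrongDual ℝ E} {ε ρ : ℝ} (hε : 0 ≤ ε) (hρ : 0 < ρ)
    (h : ∀ v, ‖v‖ = ρ → D v ≤ ε * ρ) : ‖D‖ ≤ ε := by
  refine D.opNorm_le_of_unit_norm hε fun v hv => ?_
  have apply_le (u : E) (hu : ‖u‖ = 1) : D u ≤ ε := by
    have := h (ρ • u) (by rw [norm_smul, hu, mul_one, Real.norm_of_nonneg hρ.le])
    rw [map_smul, smul_eq_mul, mul_comm ε] at this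
    exact le_of_mul_le_mul_left this hρ
  refine abs_le.2 ⟨?_, apply_le v hv⟩
  have := apply_le (-v) (by rwa [norm_neg])
  rw [map_neg] at this
  linarith

theorem exists_abs_sub_le_of_hasFDerivAt {F : E → ℝ} {D : StrongDual ℝ E} {x : E}
    (hF : HasFDerivAt F D x) {δ : ℝ} (hδ : 0 < δ) :
    ∃ ρ > 0, ∀ v, ‖v‖ ≤ ρ → |F (x + v) - F x - D v| ≤ δ * ‖v‖ := by
  rw [hasFDerivAt_iff_isLittleO_nhds_zero, Asymptotics.isLittleO_iff] at hF
  obtain ⟨ρ, hρ, h⟩ := nhds_basis_closedBall.eventually_iff.1 (hF hδ)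
  exact ⟨ρ, hρ, fun v hv => h (by simpa using hv)⟩

theorem exists_norm_fderiv_le [CompleteSpace E] {F : E → ℝ} (hF : Differentiable ℝ F)
    (hbdd : BddBelow (range F)) {ε : ℝ} (hε : 0 < ε) : ∃ x, ‖fderiv ℝ F x‖ ≤ ε := by
  obtain ⟨x, hx⟩ := exists_forall_le_add_mul_dist hF.continuous.lowerSemicontinuous hbdd
    (half_pos hε)
  obtain ⟨ρ, hρ, h⟩ :=
    exists_abs_sub_le_of_hasFDerivAt (hF x).hasFDerivAt (half_pos hε)
  refine ⟨x, norm_neg (fderiv ℝ F x) ▸ norm_le_of_forall_sphere_le hε.le hρ fun v hv => ?_⟩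
  have h₁ := hx (x + v)
  have h₂ := (abs_le.1 (h v hv.le)).2
  rw [dist_self_add_left, hv] at h₁
  rw [hv] at h₂
  rw [neg_apply]
  linarith

/-- The filter of elements of the unit ball at which the functional `φ` is almost normed, generated
by the slices `{w | ‖w‖ ≤ 1, ‖φ‖ - δ < φ w}`. -/
noncomputable def normingFilter (φ : StrongDual ℝ E) : Filter E :=
  𝓟 (closedBall 0 1) ⊓ comap φ (𝓝 ‖φ‖)

variable {φ : StrongDual ℝ E} {z : E}

theorem le_normingFilter_iff {l : Filter E} :
    l ≤ normingFilter φ ↔ l ≤ 𝓟 (closedBall 0 1) ∧ Tendsto φ l (𝓝 ‖φ‖) := by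
  rw [normingFilter, le_inf_iff, tendsto_iff_comap]

theorem apply_le_norm_of_norm_le_one (φ : StrongDual ℝ E) {w : E} (hw : ‖w‖ ≤ 1) : φ w ≤ ‖φ‖ :=
  (le_abs_self _).trans (φ.unit_le_opNorm w hw)

theorem eventually_normingFilter {P : E → Prop} :
    (∀ᶠ w in normingFilter φ, P w) ↔ ∃ δ > 0, ∀ w, ‖w‖ ≤ 1 → ‖φ‖ - δ < φ w → P w := by
  rw [normingFilter, inf_comm,
    ((nhds_basis_ball.comap φ).inf_principal (closedBall (0 : E) 1)).eventually_iff]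
  refine exists_congr fun δ => and_congr_right fun _ => ?_
  simp only [mem_inter_iff, mem_preimage, mem_ball, Real.dist_eq, mem_closedBall_zero_iff]
  constructor
  · intro h w hw hδ
    exact h ⟨abs_sub_lt_iff.2 ⟨by linarith [apply_le_norm_of_norm_le_one φ hw], by linarith⟩, hw⟩
  · intro h w hw
    exact h w hw.2 (by linarith [(abs_sub_lt_iff.1 hw.1).2])

theorem exists_lt_apply_of_pos (φ : StrongDual ℝ E) {δ : ℝ} (hδ : 0 < δ) :
    ∃ w, ‖w‖ ≤ 1 ∧ ‖φ‖ - δ < φ w := by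
  obtain ⟨w, hw, h⟩ := φ.exists_lt_apply_of_lt_opNorm (sub_lt_self ‖φ‖ hδ)
  rcases abs_cases (φ w) with ⟨habs, -⟩ | ⟨habs, -⟩
  · exact ⟨w, hw.le, by rwa [Real.norm_eq_abs, habs] at h⟩
  · exact ⟨-w, by rw [norm_neg]; exact hw.le, by rwa [map_neg, ← habs]⟩

instance (φ : StrongDual ℝ E) : (normingFilter φ).NeBot := by
  refine ⟨fun hbot => ?_⟩
  have h : ∀ᶠ w in normingFilter φ, False := by simp [hbot]
  obtain ⟨δ, hδ, h⟩ := eventually_normingFilter.1 h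
  obtain ⟨w, hw, hlt⟩ := exists_lt_apply_of_pos φ hδ
  exact h w hw hlt

theorem norm_le_one_of_normingFilter_le_nhds (hz : normingFilter φ ≤ 𝓝 z) : ‖z‖ ≤ 1 := by
  have hball : ∀ᶠ w in normingFilter φ, ‖w‖ ≤ 1 :=
    eventually_normingFilter.2 ⟨1, one_pos, fun _ hw _ => hw⟩
  exact le_of_tendsto (tendsto_norm.mono_left hz) hball

theorem apply_eq_norm_of_normingFilter_le_nhds (hz : normingFilter φ ≤ 𝓝 z) : φ z = ‖φ‖ :=
  tendsto_nhds_unique ((φ.continuous.tendsto z).mono_left hz) (le_normingFilter_iff.1 le_rfl).2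

theorem tendsto_inclusionInDoubleDual_normingFilter {D : StrongDual ℝ (StrongDual ℝ E)}
    (hD : HasFDerivAt (fun f : StrongDual ℝ E => ‖f‖) D φ) :
    Tendsto (inclusionInDoubleDual ℝ E) (normingFilter φ) (𝓝 D) := by
  refine (nhds_basis_closedBall (x := D)).tendsto_right_iff.2 fun ε hε => ?_
  obtain ⟨ρ, hρ, h⟩ := exists_abs_sub_le_of_hasFDerivAt hD (half_pos hε)
  refine eventually_normingFilter.2 ⟨ε / 2 * ρ, by positivity, fun w hw hφ => ?_⟩
  refine mem_closedBall_iff_norm.2 (norm_le_of_forall_sphere_le hε.le hρ fun v hv => ?_)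
  have h₁ := apply_le_norm_of_norm_le_one (φ + v) hw
  have h₂ := (abs_le.1 (h v hv.le)).2
  rw [hv] at h₂
  rw [add_apply] at h₁
  rw [sub_apply, dual_def]
  linarith

/-- **Šmulian's criterion**. -/
theorem hasFDerivAt_norm_of_normingFilter_le_nhds (hz : normingFilter φ ≤ 𝓝 z) :
    HasFDerivAt (fun f : StrongDual ℝ E => ‖f‖) (inclusionInDoubleDual ℝ E z) φ := by
  rw [hasFDerivAt_iff_isLittleO_nhds_zero, Asymptotics.isLittleO_iff]
  intro ε hε
  obtain ⟨δ, hδ, hslice⟩ :=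
    eventually_normingFilter.1 (hz (closedBall_mem_nhds z (half_pos hε)))
  filter_upwards [closedBall_mem_nhds 0 (by positivity : 0 < δ / (2 + ε))] with v hv
  rw [mem_closedBall_zero_iff, le_div_iff₀ (by positivity)] at hv
  rcases eq_or_ne v 0 with rfl | hv₀
  · simp
  have hv₀ : 0 < ‖v‖ := norm_pos_iff.2 hv₀
  have lower : φ z + v z ≤ ‖φ + v‖ :=
    apply_le_norm_of_norm_le_one (φ + v) (norm_le_one_of_normingFilter_le_nhds hz)
  obtain ⟨w, hw, hlt⟩ := exists_lt_apply_of_pos (φ + v) (by positivity : 0 < ε / 2 * ‖v‖)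
  rw [add_apply] at hlt
  have hvw := apply_le_norm_of_norm_le_one v hw
  have htri : ‖φ‖ - ‖v‖ ≤ ‖φ + v‖ := by simpa using norm_sub_norm_le φ (-v)
  have hwz : ‖w - z‖ ≤ ε / 2 :=
    mem_closedBall_iff_norm.1 (hslice w hw (by nlinarith))
  have hvwz : v w - v z ≤ ‖v‖ * (ε / 2) := by
    rw [← map_sub]
    exact (le_abs_self _).trans (v.le_opNorm_of_le hwz)
  rw [apply_eq_norm_of_normingFilter_le_nhds hz] at lower
  rw [dual_def, Real.norm_eq_abs, abs_le]
  constructor <;> nlinarith [apply_le_norm_of_norm_le_one φ hw]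

theorem FrechetSmooth.exists_normingFilter_le_nhds [CompleteSpace E]
    (h : FrechetSmooth (StrongDual ℝ E)) (hφ : φ ≠ 0) : ∃ z, normingFilter φ ≤ 𝓝 z := by
  have htendsto := tendsto_inclusionInDoubleDual_normingFilter (h φ hφ).hasFDerivAt
  have hcauchy : Cauchy (normingFilter φ) :=
    (inclusionInDoubleDualLi (E := E) ℝ).isometry.isUniformInducing.cauchy_map_iff.1
      htendsto.cauchy_map
  exact CompleteSpace.complete hcauchy

theorem eq_of_normingFilter_le_nhds {w : E} (hz : normingFilter φ ≤ 𝓝 z) (hw : ‖w‖ ≤ 1)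
    (hφ : φ w = ‖φ‖) : w = z := by
  have hle : pure w ≤ normingFilter φ :=
    le_normingFilter_iff.2 ⟨by simpa using hw, hφ ▸ tendsto_pure_nhds φ w⟩
  exact pure_le_nhds_iff.1 (hle.trans hz)

end Smulian

/-! ### Reflexive spaces -/

section Reflexivity

variable {E F : Type*} [NormedAddCommGroup E] [NormedSpace ℝ E]
  [NormedAddCommGroup F] [NormedSpace ℝ F]

/-- A normed space is reflexive if its canonical embedding into the bidual is onto. -/
def ReflexiveSpace (E : Type*) [NormedAddCommGroup E] [NormedSpace ℝ E] : Prop :=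
  Function.Surjective (inclusionInDoubleDual ℝ E)

theorem ReflexiveSpace.of_retract (hF : ReflexiveSpace F) {J : E →L[ℝ] F} {P : F →L[ℝ] E}
    (hPJ : ∀ x, P (J x) = x) : ReflexiveSpace E := by
  intro Φ
  obtain ⟨y, hy⟩ := hF (Φ.comp (ContinuousLinearMap.precomp ℝ J))
  refine ⟨P y, ContinuousLinearMap.ext fun f => ?_⟩
  have h : (f.comp P).comp J = f := ContinuousLinearMap.ext fun x => congrArg f (hPJ x)
  calc f (P y) = Φ ((f.comp P).comp J) := DFunLike.congr_fun hy (f.comp P)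
    _ = Φ f := by rw [h]

theorem ReflexiveSpace.prod (hE : ReflexiveSpace E) (hF : ReflexiveSpace F) :
    ReflexiveSpace (E × F) := by
  intro Φ
  obtain ⟨x, hx⟩ := hE (Φ.comp (ContinuousLinearMap.precomp ℝ (ContinuousLinearMap.fst ℝ E F)))
  obtain ⟨y, hy⟩ := hF (Φ.comp (ContinuousLinearMap.precomp ℝ (ContinuousLinearMap.snd ℝ E F)))
  refine ⟨(x, y), ContinuousLinearMap.ext fun f => ?_⟩
  let f₁ := f.comp (ContinuousLinearMap.inl ℝ E F)
  let f₂ := f.comp (ContinuousLinearMap.inr ℝ E F)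
  have hf : f₁.comp (ContinuousLinearMap.fst ℝ E F) + f₂.comp (ContinuousLinearMap.snd ℝ E F) = f :=
    ContinuousLinearMap.ext fun z => by
      simp [f₁, f₂, ← map_add]
  calc f (x, y) = f₁ x + f₂ y := by simp [f₁, f₂, ← map_add]
    _ = Φ (f₁.comp (ContinuousLinearMap.fst ℝ E F)) + Φ (f₂.comp (ContinuousLinearMap.snd ℝ E F)) :=
      congrArg₂ (· + ·) (DFunLike.congr_fun hx f₁) (DFunLike.congr_fun hy f₂)
    _ = Φ f := by rw [← map_add, hf]

theorem hasFDerivAt_norm_sq_zero : HasFDerivAt (fun v : E => ‖v‖ ^ 2) (0 : StrongDual ℝ E) 0 := by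
  rw [hasFDerivAt_iff_isLittleO_nhds_zero]
  simpa using Asymptotics.isLittleO_norm_pow_id one_lt_two (E' := E)

theorem FrechetSmooth.hasFDerivAt_norm_sq [CompleteSpace E] (h : FrechetSmooth (StrongDual ℝ E))
    (φ : StrongDual ℝ E) :
    ∃ z, HasFDerivAt (fun f : StrongDual ℝ E => ‖f‖ ^ 2) (inclusionInDoubleDual ℝ E z) φ := by
  rcases eq_or_ne φ 0 with rfl | hφ
  · exact ⟨0, by simpa using hasFDerivAt_norm_sq_zero (E := StrongDual ℝ E)⟩
  · obtain ⟨z, hz⟩ := h.exists_normingFilter_le_nhds hφ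
    refine ⟨(2 * ‖φ‖) • z, ?_⟩
    simpa [map_smul] using (hasFDerivAt_norm_of_normingFilter_le_nhds hz).pow 2

theorem FrechetSmooth.reflexiveSpace [CompleteSpace E] (h : FrechetSmooth (StrongDual ℝ E)) :
    ReflexiveSpace E := by
  intro Φ
  let G : StrongDual ℝ E → ℝ := fun f => ‖f‖ ^ 2 - Φ f
  have hasFDerivAt_G (f : StrongDual ℝ E) :
      ∃ z, HasFDerivAt G (inclusionInDoubleDual ℝ E z - Φ) f :=
    (h.hasFDerivAt_norm_sq f).imp fun z hz => hz.sub Φ.hasFDerivAt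
  have bddBelow_G : BddBelow (range G) := by
    refine ⟨-(‖Φ‖ ^ 2 / 4), ?_⟩
    rintro _ ⟨f, rfl⟩
    have := (le_abs_self _).trans (Φ.le_opNorm f)
    nlinarith [sq_nonneg (‖f‖ - ‖Φ‖ / 2)]
  have hisometry : Isometry (inclusionInDoubleDual ℝ E) := (inclusionInDoubleDualLi ℝ).isometry
  have hclosed : IsClosed (range (inclusionInDoubleDual ℝ E)) :=
    hisometry.isClosedEmbedding.isClosed_range
  suffices Φ ∈ closure (range (inclusionInDoubleDual ℝ E)) from hclosed.closure_eq.subset this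
  refine (SeminormedAddCommGroup.mem_closure_iff (a := Φ)).2 fun ε hε => ?_
  obtain ⟨f, hf⟩ := exists_norm_fderiv_le
    (fun f => (hasFDerivAt_G f).choose_spec.differentiableAt) bddBelow_G (half_pos hε)
  obtain ⟨z, hz⟩ := hasFDerivAt_G f
  rw [hz.fderiv, norm_sub_rev] at hf
  exact ⟨_, mem_range_self z, hf.trans_lt (half_lt_self hε)⟩

theorem exists_pointwise_limit {ι : Type*} (U : Ultrafilter ι) {f : ι → StrongDual ℝ E} {R : ℝ}
    (hf : ∀ᶠ i in (U : Filter ι), ‖f i‖ ≤ R) :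
    ∃ g : StrongDual ℝ E, ‖g‖ ≤ R ∧ ∀ x, Tendsto (fun i => f i x) U (𝓝 (g x)) := by
  have hcompact := WeakDual.isCompact_closedBall (𝕜 := ℝ) (0 : StrongDual ℝ E) R
  obtain ⟨g, hg, hle⟩ := hcompact.ultrafilter_le_nhds (U.map fun i => StrongDual.toWeakDual (f i))
    (le_principal_iff.2 (hf.mono fun i hi => by simpa using hi))
  refine ⟨WeakDual.toStrongDual g, by simpa using hg, fun x => ?_⟩
  exact ((WeakDual.eval_continuous x).tendsto g).comp hle

theorem ReflexiveSpace.exists_weak_limit (hE : ReflexiveSpace E) {ι : Type*} (U : Ultrafilter ι)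
    {w : ι → E} {R : ℝ} (hw : ∀ᶠ i in (U : Filter ι), ‖w i‖ ≤ R) :
    ∃ z, ‖z‖ ≤ R ∧ ∀ f : StrongDual ℝ E, Tendsto (fun i => f (w i)) U (𝓝 (f z)) := by
  obtain ⟨Φ, hΦ, hlim⟩ := exists_pointwise_limit U (f := fun i => inclusionInDoubleDual ℝ E (w i))
    (hw.mono fun i hi => (double_dual_bound ℝ E (w i)).trans hi)
  obtain ⟨z, rfl⟩ := hE Φ
  exact ⟨z, by rwa [← (inclusionInDoubleDualLi (E := E) ℝ).norm_map z], hlim⟩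

end Reflexivity

section HilbertSum

variable {α : Type*} {Y : α → Type*} [∀ k, NormedAddCommGroup (Y k)]

theorem sum_norm_sq_le_lp_norm_sq (y : lp Y 2) (s : Finset α) : ∑ k ∈ s, ‖y k‖ ^ 2 ≤ ‖y‖ ^ 2 := by
  simpa using lp.sum_rpow_le_norm_rpow (by norm_num) y s

theorem lp_norm_le_of_forall_sum_sq_le {y : lp Y 2} {C : ℝ} (hC : 0 ≤ C)
    (h : ∀ s : Finset α, ∑ k ∈ s, ‖y k‖ ^ 2 ≤ C ^ 2) : ‖y‖ ≤ C :=
  lp.norm_le_of_forall_sum_le (by norm_num) hC (by simpa using h)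

theorem lp_norm_sum_single_sq [DecidableEq α] (v : ∀ k, Y k) (s : Finset α) :
    ‖∑ k ∈ s, lp.single 2 k (v k)‖ ^ 2 = ∑ k ∈ s, ‖v k‖ ^ 2 := by
  simpa using lp.norm_sum_single (p := 2) (by norm_num) v s

theorem sum_norm_sub_sq_le (y z : lp Y 2) (s : Finset α) :
    ∑ k ∈ s, ‖y k - z k‖ ^ 2 ≤ 2 * ∑ k ∈ s, ‖y k‖ ^ 2 + 2 * ∑ k ∈ s, ‖z k‖ ^ 2 := by
  rw [Finset.mul_sum, Finset.mul_sum, ← Finset.sum_add_distrib]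
  refine Finset.sum_le_sum fun k _ => ?_
  have := norm_sub_le (y k) (z k)
  nlinarith [norm_nonneg (y k - z k), sq_nonneg (‖y k‖ - ‖z k‖)]

theorem exists_sum_norm_sq_lt_of_disjoint (y : lp Y 2) {ε : ℝ} (hε : 0 < ε) :
    ∃ s : Finset α, ∀ t, Disjoint t s → ∑ k ∈ t, ‖y k‖ ^ 2 < ε := by
  have hsum : Summable fun k => ‖y k‖ ^ 2 := by
    simpa using (lp.memℓp y).summable (by norm_num)
  obtain ⟨s, hs⟩ := summable_iff_vanishing_norm.1 hsum ε hε
  exact ⟨s, fun t ht => (le_abs_self _).trans_lt (hs t ht)⟩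

theorem tendsto_lp_of_forall_tendsto_of_tail {ι : Type*} {l : Filter ι} {w : ι → lp Y 2}
    {y : lp Y 2} (hcoord : ∀ k, Tendsto (fun i => w i k) l (𝓝 (y k)))
    (htail : ∀ ε > 0, ∃ s : Finset α, ∀ᶠ i in l, ∀ t, Disjoint t s → ∑ k ∈ t, ‖w i k‖ ^ 2 ≤ ε) :
    Tendsto w l (𝓝 y) := by
  classical
  refine tendsto_iff_norm_sub_tendsto_zero.2 ?_
  refine (nhds_basis_closedBall.tendsto_right_iff).2 fun ε hε => ?_
  obtain ⟨s₁, hs₁⟩ := htail (ε ^ 2 / 5) (by positivity)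
  obtain ⟨s₂, hs₂⟩ := exists_sum_norm_sq_lt_of_disjoint y (by positivity : 0 < ε ^ 2 / 5)
  have hhead : Tendsto (fun i => ∑ k ∈ s₁ ∪ s₂, ‖w i k - y k‖ ^ 2) l (𝓝 0) := by
    simpa using tendsto_finsetSum (s₁ ∪ s₂) fun k _ =>
      (tendsto_iff_norm_sub_tendsto_zero.1 (hcoord k)).pow 2
  filter_upwards [hs₁, hhead.eventually_le_const (by positivity : 0 < ε ^ 2 / 5)] with i hi₁ hi
  rw [mem_closedBall_zero_iff, norm_norm]
  refine lp_norm_le_of_forall_sum_sq_le hε.le fun t => ?_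
  have hdisj : Disjoint (t \ (s₁ ∪ s₂)) (s₁ ∪ s₂) := Finset.sdiff_disjoint
  rw [Finset.disjoint_union_right] at hdisj
  calc ∑ k ∈ t, ‖w i k - y k‖ ^ 2
      ≤ ∑ k ∈ t \ (s₁ ∪ s₂) ∪ (s₁ ∪ s₂), ‖w i k - y k‖ ^ 2 :=
        Finset.sum_le_sum_of_subset_of_nonneg (by simp) fun _ _ _ => by positivity
    _ = ∑ k ∈ t \ (s₁ ∪ s₂), ‖w i k - y k‖ ^ 2 + ∑ k ∈ s₁ ∪ s₂, ‖w i k - y k‖ ^ 2 :=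
        Finset.sum_union Finset.sdiff_disjoint
    _ ≤ ε ^ 2 := by
        linarith [sum_norm_sub_sq_le (w i) y (t \ (s₁ ∪ s₂)), hi₁ _ hdisj.1, hs₂ _ hdisj.2]

theorem le_sq_of_le_mul_sqrt {a b : ℝ} (ha : 0 ≤ a) (h : a ≤ b * √a) : a ≤ b ^ 2 := by
  rcases ha.eq_or_lt with rfl | ha
  · positivity
  have hsqrt : √a ≤ b := by
    refine le_of_mul_le_mul_right ?_ (Real.sqrt_pos.2 ha)
    rwa [Real.mul_self_sqrt ha.le]
  calc a = √a ^ 2 := (Real.sq_sqrt ha.le).symm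
    _ ≤ b ^ 2 := by gcongr

variable [∀ k, NormedSpace ℝ (Y k)]

theorem norm_sum_comp_evalCLM_le (g : ∀ k, StrongDual ℝ (Y k)) (s : Finset α) :
    ‖∑ k ∈ s, (g k).comp (lp.evalCLM ℝ Y 2 k)‖ ≤ √(∑ k ∈ s, ‖g k‖ ^ 2) := by
  refine ContinuousLinearMap.opNorm_le_bound _ (Real.sqrt_nonneg _) fun w => ?_
  calc ‖(∑ k ∈ s, (g k).comp (lp.evalCLM ℝ Y 2 k)) w‖ = ‖∑ k ∈ s, g k (w k)‖ := by
        rw [sum_apply]; rfl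
    _ ≤ ∑ k ∈ s, ‖g k‖ * ‖w k‖ := norm_sum_le_of_le _ fun k _ => (g k).le_opNorm (w k)
    _ ≤ √(∑ k ∈ s, ‖g k‖ ^ 2) * √(∑ k ∈ s, ‖w k‖ ^ 2) := Real.sum_mul_le_sqrt_mul_sqrt s _ _
    _ ≤ √(∑ k ∈ s, ‖g k‖ ^ 2) * ‖w‖ := by
        gcongr
        exact (Real.sqrt_le_left (norm_nonneg w)).2 (sum_norm_sq_le_lp_norm_sq w s)

theorem sum_norm_comp_single_sq_le [DecidableEq α] (φ : StrongDual ℝ (lp Y 2)) (s : Finset α) :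
    ∑ k ∈ s, ‖φ.comp (lp.singleContinuousLinearMap ℝ Y 2 k)‖ ^ 2 ≤ (2 * ‖φ‖) ^ 2 := by
  set g : ∀ k, StrongDual ℝ (Y k) := fun k => φ.comp (lp.singleContinuousLinearMap ℝ Y 2 k)
  have exists_half_norming (k : α) : ∃ v, ‖v‖ ≤ 1 ∧ ‖g k‖ / 2 ≤ g k v := by
    rcases (norm_nonneg (g k)).eq_or_lt with h | h
    · exact ⟨0, by simp, by simp [← h]⟩
    · obtain ⟨v, hv, hlt⟩ := exists_lt_apply_of_pos (g k) (half_pos h)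
      exact ⟨v, hv, by linarith⟩
  choose v norm_v_le le_apply_v using exists_half_norming
  let w : lp Y 2 := ∑ k ∈ s, lp.single 2 k (‖g k‖ • v k)
  have norm_w_le : ‖w‖ ≤ √(∑ k ∈ s, ‖g k‖ ^ 2) := by
    refine Real.le_sqrt_of_sq_le ?_
    rw [lp_norm_sum_single_sq]
    gcongr with k
    rw [norm_smul, norm_norm]
    exact mul_le_of_le_one_right (norm_nonneg _) (norm_v_le k)
  refine le_sq_of_le_mul_sqrt (by positivity) ?_
  calc ∑ k ∈ s, ‖g k‖ ^ 2 = 2 * ∑ k ∈ s, ‖g k‖ * (‖g k‖ / 2) := by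
        rw [Finset.mul_sum]; exact Finset.sum_congr rfl fun k _ => by ring
    _ ≤ 2 * ∑ k ∈ s, ‖g k‖ * g k (v k) := by gcongr with k; exact le_apply_v k
    _ = 2 * φ w := by
        simp only [w, map_sum, ← smul_eq_mul, ← map_smul]; rfl
    _ ≤ 2 * ‖φ‖ * √(∑ k ∈ s, ‖g k‖ ^ 2) := by
        rw [mul_assoc]
        gcongr
        exact (le_abs_self _).trans (φ.le_opNorm_of_le norm_w_le)

theorem hasSum_comp_single_comp_evalCLM [DecidableEq α] (φ : StrongDual ℝ (lp Y 2)) :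
    HasSum (fun k => (φ.comp (lp.singleContinuousLinearMap ℝ Y 2 k)).comp (lp.evalCLM ℝ Y 2 k))
      φ := by
  have hsq : Summable fun k => ‖φ.comp (lp.singleContinuousLinearMap ℝ Y 2 k)‖ ^ 2 :=
    summable_of_sum_le (fun _ => by positivity) (sum_norm_comp_single_sq_le φ)
  have hsummable : Summable fun k =>
      (φ.comp (lp.singleContinuousLinearMap ℝ Y 2 k)).comp (lp.evalCLM ℝ Y 2 k) := by
    refine summable_iff_vanishing_norm.2 fun ε hε => ?_
    obtain ⟨s, hs⟩ := summable_iff_vanishing_norm.1 hsq (ε ^ 2) (by positivity)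
    refine ⟨s, fun t ht => (norm_sum_comp_evalCLM_le _ t).trans_lt ?_⟩
    exact (Real.sqrt_lt' hε).2 ((le_abs_self _).trans_lt (hs t ht))
  convert hsummable.hasSum
  refine ContinuousLinearMap.ext fun w => HasSum.unique ?_
    ((ContinuousLinearMap.apply ℝ ℝ w).hasSum hsummable.hasSum)
  exact φ.hasSum (lp.hasSum_single (by simp) w)

theorem ReflexiveSpace.lp_two (hY : ∀ k, ReflexiveSpace (Y k)) : ReflexiveSpace (lp Y 2) := by
  intro Φ
  choose y hy using fun k => hY k (Φ.comp (ContinuousLinearMap.precomp ℝ (lp.evalCLM ℝ Y 2 k)))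
  have Φ_apply (k : α) (g : StrongDual ℝ (Y k)) : Φ (g.comp (lp.evalCLM ℝ Y 2 k)) = g (y k) :=
    (DFunLike.congr_fun (hy k) g).symm
  have sum_sq_le (s : Finset α) : ∑ k ∈ s, ‖y k‖ ^ 2 ≤ ‖Φ‖ ^ 2 := by
    choose g norm_g_le g_apply using fun k => exists_dual_vector'' ℝ (y k)
    refine le_sq_of_le_mul_sqrt (by positivity) ?_
    calc ∑ k ∈ s, ‖y k‖ ^ 2 = Φ (∑ k ∈ s, (‖y k‖ • g k).comp (lp.evalCLM ℝ Y 2 k)) := by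
          simp only [map_sum, Φ_apply, smul_apply, g_apply, smul_eq_mul, sq,
            RCLike.ofReal_real_eq_id, id_eq]
      _ ≤ ‖Φ‖ * √(∑ k ∈ s, ‖‖y k‖ • g k‖ ^ 2) :=
          (le_abs_self _).trans (Φ.le_opNorm_of_le (norm_sum_comp_evalCLM_le _ s))
      _ ≤ ‖Φ‖ * √(∑ k ∈ s, ‖y k‖ ^ 2) := by
          gcongr with k
          rw [norm_smul, norm_norm]
          exact mul_le_of_le_one_right (norm_nonneg _) (norm_g_le k)
  let z : lp Y 2 := ⟨y, memℓp_gen' (C := ‖Φ‖ ^ 2) (by simpa using sum_sq_le)⟩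
  refine ⟨z, ContinuousLinearMap.ext fun φ => ?_⟩
  classical
  have hφ := hasSum_comp_single_comp_evalCLM φ
  refine ((inclusionInDoubleDual ℝ _ z).hasSum hφ).unique ?_
  convert Φ.hasSum hφ using 2 with k
  exact (Φ_apply k (φ.comp (lp.singleContinuousLinearMap ℝ Y 2 k))).symm

end HilbertSum

/-! ### The Kadec–Klee property and tangent directions -/

section KadecKlee

variable {E : Type*} [NormedAddCommGroup E] [NormedSpace ℝ E]

/-- The Kadec–Klee property, formulated with filters instead of nets: on the unit sphere, weak
convergence from within the unit ball implies norm convergence. -/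
def KadecKlee (E : Type*) [NormedAddCommGroup E] [NormedSpace ℝ E] : Prop :=
  ∀ z : E, ‖z‖ = 1 → ∀ l ≤ 𝓟 (closedBall 0 1),
    (∀ f : StrongDual ℝ E, Tendsto f l (𝓝 (f z))) → l ≤ 𝓝 z

theorem frechetSmooth_dual_of_reflexiveSpace_of_kadecKlee [StrictConvexSpace ℝ E]
    (hE : ReflexiveSpace E) (hKK : KadecKlee E) : FrechetSmooth (StrongDual ℝ E) := by
  intro φ hφ
  have exists_norming (U : Ultrafilter E) (hU : ↑U ≤ normingFilter φ) :
      ∃ z, ‖z‖ = 1 ∧ φ z = ‖φ‖ ∧ ↑U ≤ 𝓝 z := by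
    obtain ⟨hball, hnorming⟩ := le_normingFilter_iff.1 hU
    have norm_le : ∀ᶠ w in (U : Filter E), ‖id w‖ ≤ 1 := by
      filter_upwards [le_principal_iff.1 hball] with w hw using mem_closedBall_zero_iff.1 hw
    obtain ⟨z, hz, hlim⟩ := hE.exists_weak_limit U norm_le
    have hφz : φ z = ‖φ‖ := tendsto_nhds_unique (hlim φ) hnorming
    have norm_z : ‖z‖ = 1 := by
      refine hz.antisymm (le_of_mul_le_mul_left ?_ (norm_pos_iff.2 hφ))
      calc ‖φ‖ * 1 = φ z := by rw [mul_one, hφz]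
        _ ≤ ‖φ‖ * ‖z‖ := (le_abs_self _).trans (φ.le_opNorm z)
    exact ⟨z, norm_z, hφz, hKK z norm_z U hball hlim⟩
  have unique_norming {z z' : E} (hz : ‖z‖ = 1) (hz' : ‖z'‖ = 1) (hφz : φ z = ‖φ‖)
      (hφz' : φ z' = ‖φ‖) : z = z' := by
    refine eq_of_norm_eq_of_norm_add_eq (hz.trans hz'.symm) ((norm_add_le z z').antisymm ?_)
    have := (le_abs_self _).trans (φ.le_opNorm (z + z'))
    rw [map_add, hφz, hφz', ← mul_two] at this
    rw [hz, hz', one_add_one_eq_two]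
    exact le_of_mul_le_mul_left this (norm_pos_iff.2 hφ)
  obtain ⟨z, hz, hφz, -⟩ := exists_norming (Ultrafilter.of _) (Ultrafilter.of_le _)
  refine (hasFDerivAt_norm_of_normingFilter_le_nhds (z := z) ?_).differentiableAt
  refine le_iff_ultrafilter.2 fun U hU => ?_
  obtain ⟨z', hz', hφz', hle⟩ := exists_norming U hU
  rwa [unique_norming hz hz' hφz hφz']

theorem tendsto_of_weak_tendsto_of_forall_null {ι : Type*} {U : Ultrafilter ι} {w : ι → E} {x : E}
    (hweak : ∀ f : StrongDual ℝ E, Tendsto (fun i => f (w i)) U (𝓝 (f x)))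
    (hnull : ∀ h : ι → StrongDual ℝ E, (∀ i, ‖h i‖ ≤ 2) →
      (∀ v, Tendsto (fun i => h i v) U (𝓝 0)) → ∀ ε > 0, ∀ᶠ i in (U : Filter ι), h i (w i) ≤ ε) :
    Tendsto w U (𝓝 x) := by
  choose H norm_H_le H_apply using fun i => exists_dual_vector'' ℝ (w i - x)
  obtain ⟨g, norm_g_le, hg⟩ := exists_pointwise_limit U (.of_forall norm_H_le)
  have norm_sub_le (i : ι) : ‖H i - g‖ ≤ 2 :=
    (norm_sub_le _ _).trans (by linarith [norm_H_le i])
  have sub_tendsto (v : E) : Tendsto (fun i => (H i - g) v) U (𝓝 0) := by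
    simpa using (hg v).sub_const (g v)
  refine tendsto_iff_norm_sub_tendsto_zero.2 (nhds_basis_closedBall.tendsto_right_iff.2 ?_)
  intro ε hε
  have hgw : Tendsto (fun i => g (w i) - g x) U (𝓝 0) := by
    simpa using (hweak g).sub_const (g x)
  filter_upwards [hnull _ norm_sub_le sub_tendsto (ε / 3) (by positivity),
    (sub_tendsto x).eventually_const_le (by linarith : -(ε / 3) < 0),
    hgw.eventually_le_const (by positivity : 0 < ε / 3)] with i h₁ h₂ h₃
  have norm_eq : ‖w i - x‖ = (H i - g) (w i) - (H i - g) x + (g (w i) - g x) := by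
    rw [← map_sub, sub_apply, ← map_sub g, H_apply]
    simp
  rw [mem_closedBall_zero_iff, norm_norm]
  linarith

end KadecKlee

section Tangent

variable {V : Type*} [NormedAddCommGroup V] [NormedSpace ℝ V] {ι : Type*} {l : Filter ι}
  {F : V} {h : ι → V} {R : ℝ}

/-- The directions `h i` leave the unit ball at `F` only to second order: along `l`, the norm of
`F + η • h i` is at most `1 + o(η)` as `η` decreases to `0`. -/
def IsTangent (l : Filter ι) (F : V) (h : ι → V) : Prop :=
  ∀ δ > 0, ∀ᶠ η : ℝ in 𝓝[>] 0, ∀ᶠ i in l, ‖F + η • h i‖ ≤ 1 + δ * η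

theorem eventually_nhdsGT_zero_mul_le (a : ℝ) {b : ℝ} (hb : 0 < b) :
    ∀ᶠ η : ℝ in 𝓝[>] 0, η * a ≤ b := by
  have h : Tendsto (fun η : ℝ => η * a) (𝓝[>] 0) (𝓝 0) :=
    tendsto_nhdsWithin_of_tendsto_nhds (by simpa using (continuous_mul_const a).tendsto 0)
  exact h.eventually_le_const hb

theorem isTangent_of_norm_lt_one (hF : ‖F‖ < 1) (hR : ∀ᶠ i in l, ‖h i‖ ≤ R) :
    IsTangent l F h := by
  intro δ hδ
  filter_upwards [eventually_nhdsGT_zero_mul_le R (sub_pos.2 hF), self_mem_nhdsWithin]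
    with η hη hpos
  filter_upwards [hR] with i hi
  have hpos : 0 < η := hpos
  calc ‖F + η • h i‖ ≤ ‖F‖ + η * ‖h i‖ := by
        simpa [norm_smul, abs_of_pos hpos] using norm_add_le F (η • h i)
    _ ≤ 1 + δ * η := by nlinarith [mul_pos hδ hpos]

theorem isTangent_of_hasFDerivAt_norm {D : StrongDual ℝ V} (hF : ‖F‖ ≤ 1)
    (hD : HasFDerivAt (fun v : V => ‖v‖) D F) (hR : ∀ᶠ i in l, ‖h i‖ ≤ R)
    (hlim : Tendsto (fun i => D (h i)) l (𝓝 0)) : IsTangent l F h := by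
  intro δ hδ
  obtain ⟨ρ, hρ, hdiff⟩ :=
    exists_abs_sub_le_of_hasFDerivAt hD (by positivity : 0 < δ / 2 / (|R| + 1))
  filter_upwards [eventually_nhdsGT_zero_mul_le |R| hρ, self_mem_nhdsWithin] with η hη hpos
  filter_upwards [hR, hlim.eventually_le_const (half_pos hδ)] with i hi hDi
  have hpos : 0 < η := hpos
  have norm_smul_le : ‖η • h i‖ ≤ η * |R| := by
    rw [norm_smul, Real.norm_of_nonneg hpos.le]
    gcongr
    exact hi.trans (le_abs_self R)
  have remainder_le : δ / 2 / (|R| + 1) * ‖η • h i‖ ≤ δ / 2 * η := by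
    calc δ / 2 / (|R| + 1) * ‖η • h i‖ ≤ δ / 2 / (|R| + 1) * (η * (|R| + 1)) := by
          gcongr; nlinarith
      _ = δ / 2 * η := by field_simp
  have := (abs_le.1 (hdiff (η • h i) (norm_smul_le.trans hη))).2
  rw [map_smul, smul_eq_mul] at this
  nlinarith

theorem isTangent_zero (hF : ‖F‖ ≤ 1) : IsTangent l F fun _ : ι => (0 : V) := by
  intro δ hδ
  filter_upwards [self_mem_nhdsWithin] with η hpos
  have := mul_pos hδ hpos
  exact .of_forall fun _ => by rw [smul_zero, add_zero]; linarith

variable {E : Type*} [NormedAddCommGroup E] [NormedSpace ℝ E] [CompleteSpace E]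
  {φ : StrongDual ℝ E} {h : ι → StrongDual ℝ E}

theorem FrechetSmooth.isTangent_of_norming (hE : FrechetSmooth (StrongDual ℝ E)) (hφ : ‖φ‖ = 1)
    {u : E} (hu : ‖u‖ ≤ 1) (hφu : φ u = 1) (hR : ∀ᶠ i in l, ‖h i‖ ≤ R)
    (hlim : Tendsto (fun i => h i u) l (𝓝 0)) : IsTangent l φ h := by
  obtain ⟨z, hz⟩ := hE.exists_normingFilter_le_nhds (norm_ne_zero_iff.1 (hφ ▸ one_ne_zero))
  obtain rfl := eq_of_normingFilter_le_nhds hz hu (hφu.trans hφ.symm)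
  exact isTangent_of_hasFDerivAt_norm hφ.le (hasFDerivAt_norm_of_normingFilter_le_nhds hz) hR hlim

theorem FrechetSmooth.exists_forall_isTangent (hE : FrechetSmooth (StrongDual ℝ E))
    (hφ : ‖φ‖ ≤ 1) : ∃ u : E, ∀ {ι : Type*} {l : Filter ι} {h : ι → StrongDual ℝ E} {R : ℝ},
      (∀ᶠ i in l, ‖h i‖ ≤ R) → Tendsto (fun i => h i u) l (𝓝 0) → IsTangent l φ h := by
  rcases hφ.lt_or_eq with hlt | heq
  · exact ⟨0, fun hR _ => isTangent_of_norm_lt_one hlt hR⟩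
  · obtain ⟨z, hz⟩ := hE.exists_normingFilter_le_nhds (norm_ne_zero_iff.1 (heq ▸ one_ne_zero))
    exact ⟨z, hE.isTangent_of_norming heq (norm_le_one_of_normingFilter_le_nhds hz)
      ((apply_eq_norm_of_normingFilter_le_nhds hz).trans heq)⟩

end Tangent

section TangentLine

variable {V : Type*} [NormedAddCommGroup V] [NormedSpace ℝ V] {F v : V}

/-- The line through `F` in direction `v` leaves the unit ball at `F` only to second order, on
both sides: either it is tangent to the unit sphere at `F`, or `F` lies in the open unit ball. -/
def IsTangentLine (F v : V) : Prop :=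
  ∀ a : ℝ, IsTangent (pure ()) F fun _ => a • v

theorem isTangentLine_zero (hF : ‖F‖ ≤ 1) : IsTangentLine F (0 : V) := fun a => by
  simpa only [smul_zero] using isTangent_zero hF

theorem isTangentLine_of_norm_lt_one (hF : ‖F‖ < 1) : IsTangentLine F v := fun _ =>
  isTangent_of_norm_lt_one hF (.of_forall fun _ => le_rfl)

variable {E : Type*} [NormedAddCommGroup E] [NormedSpace ℝ E] [CompleteSpace E]
  {φ : StrongDual ℝ E}

theorem FrechetSmooth.isTangentLine_of_norming (hE : FrechetSmooth (StrongDual ℝ E))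
    (hφ : ‖φ‖ = 1) {u : E} (hu : ‖u‖ ≤ 1) (hφu : φ u = 1) {h : StrongDual ℝ E} (hh : h u = 0) :
    IsTangentLine φ h := fun a =>
  hE.isTangent_of_norming hφ hu hφu (.of_forall fun _ => le_rfl)
    (by simp only [smul_apply, hh, smul_zero, tendsto_const_nhds_iff])

theorem FrechetSmooth.exists_forall_isTangentLine (hE : FrechetSmooth (StrongDual ℝ E))
    (hφ : ‖φ‖ ≤ 1) : ∃ u : E, ∀ h : StrongDual ℝ E, h u = 0 → IsTangentLine φ h := by
  obtain ⟨u, hu⟩ := hE.exists_forall_isTangent hφ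
  exact ⟨u, fun h hh a => hu (.of_forall fun _ => le_rfl)
    (by simp only [smul_apply, hh, smul_zero, tendsto_const_nhds_iff])⟩

end TangentLine

/-! ### Functionals on generalized sums -/

namespace SumNorms

variable {X : Type*} [NormedAddCommGroup X] [NormedSpace ℝ X]
  {Y : ℕ → Type*} [∀ k, NormedAddCommGroup (Y k)] [∀ k, NormedSpace ℝ (Y k)] (S : SumNorms X Y)

section Pair

variable (k : ℕ)

/-- The inclusion of `X` into `X ⊕ Y k`. -/
noncomputable def Pair.inl : X →L[ℝ] S.Pair k :=
  LinearMap.mkContinuous (LinearMap.inl ℝ X (Y k) : X →ₗ[ℝ] S.Pair k) 1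
    (fun x => by rw [one_mul]; exact (S.nrm_left k x).le)

/-- The inclusion of `Y k` into `X ⊕ Y k`. -/
noncomputable def Pair.inr : Y k →L[ℝ] S.Pair k :=
  LinearMap.mkContinuous (LinearMap.inr ℝ X (Y k) : Y k →ₗ[ℝ] S.Pair k) 1
    (fun y => by rw [one_mul]; exact (S.nrm_right k y).le)

theorem Pair.norm_inl (x : X) : ‖Pair.inl S k x‖ = ‖x‖ := S.nrm_left k x

theorem Pair.norm_inr (y : Y k) : ‖Pair.inr S k y‖ = ‖y‖ := S.nrm_right k y

theorem Pair.inl_fst_add_inr_snd (z : S.Pair k) :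
    Pair.inl S k (Pair.fst S k z) + Pair.inr S k (Pair.snd S k z) = z :=
  Prod.ext (add_zero _) (zero_add _)

/-- The identity of `X × Y k`, as an isomorphism of the normed space `X ⊕ Y k` with the product
equipped with the supremum norm. -/
noncomputable def Pair.equivProd : S.Pair k ≃L[ℝ] X × Y k :=
  ContinuousLinearEquiv.equivOfInverse ((Pair.fst S k).prod (Pair.snd S k))
    ((Pair.inl S k).coprod (Pair.inr S k)) (Pair.inl_fst_add_inr_snd S k)
    fun _ => Prod.ext (add_zero _) (zero_add _)

instance [CompleteSpace X] [∀ k, CompleteSpace (Y k)] : CompleteSpace (S.Pair k) :=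
  (completeSpace_congr (e := (Pair.equivProd S k).toEquiv)
    (Pair.equivProd S k).isUniformEmbedding).2 inferInstance

variable {k}

theorem Pair.functional_inl (f : StrongDual ℝ X) (g : StrongDual ℝ (Y k)) (x : X) :
    Pair.functional S k f g (Pair.inl S k x) = f x := by
  change f x + g 0 = f x
  rw [map_zero, add_zero]

theorem Pair.functional_inr (f : StrongDual ℝ X) (g : StrongDual ℝ (Y k)) (y : Y k) :
    Pair.functional S k f g (Pair.inr S k y) = g y := by
  change f 0 + g y = g y
  rw [map_zero, zero_add]

theorem Pair.functional_zero : Pair.functional S k 0 0 = 0 :=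
  ContinuousLinearMap.ext fun _ => add_zero 0

theorem Pair.functional_add_smul (f f' : StrongDual ℝ X) (g g' : StrongDual ℝ (Y k)) (a : ℝ) :
    Pair.functional S k (f + a • f') (g + a • g') =
      Pair.functional S k f g + a • Pair.functional S k f' g' := by
  ext z
  simp only [Pair.functional_apply, add_apply, smul_apply, smul_eq_mul]
  ring

theorem Pair.functional_smul (a : ℝ) (f : StrongDual ℝ X) (g : StrongDual ℝ (Y k)) :
    Pair.functional S k (a • f) (a • g) = a • Pair.functional S k f g := by
  ext z
  simp only [Pair.functional_apply, smul_apply, smul_eq_mul, mul_add]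

theorem Pair.norm_left_le_norm_functional (f : StrongDual ℝ X) (g : StrongDual ℝ (Y k)) :
    ‖f‖ ≤ ‖Pair.functional S k f g‖ := by
  refine ContinuousLinearMap.opNorm_le_bound _ (norm_nonneg _) fun x => ?_
  rw [← Pair.functional_inl S f g, ← Pair.norm_inl S k x]
  exact ContinuousLinearMap.le_opNorm _ _

theorem Pair.norm_right_le_norm_functional (f : StrongDual ℝ X) (g : StrongDual ℝ (Y k)) :
    ‖g‖ ≤ ‖Pair.functional S k f g‖ := by
  refine ContinuousLinearMap.opNorm_le_bound _ (norm_nonneg _) fun y => ?_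
  rw [← Pair.functional_inr S f g, ← Pair.norm_inr S k y]
  exact ContinuousLinearMap.le_opNorm _ _

theorem Pair.norm_fst_le (z : S.Pair k) : ‖Pair.fst S k z‖ ≤ ‖z‖ := S.nrm_mono k z.1 z.2

theorem Pair.norm_functional_zero_right (f : StrongDual ℝ X) :
    ‖Pair.functional S k f 0‖ = ‖f‖ := by
  refine le_antisymm ?_ (Pair.norm_left_le_norm_functional S f 0)
  refine ContinuousLinearMap.opNorm_le_bound _ (norm_nonneg _) fun z => ?_
  rw [Pair.functional_apply, zero_apply, add_zero]
  exact f.le_opNorm_of_le (Pair.norm_fst_le S z)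

theorem Pair.norm_functional_le (f : StrongDual ℝ X) (g : StrongDual ℝ (Y k)) :
    ‖Pair.functional S k f g‖ ≤ ‖f‖ + 2 * ‖g‖ := by
  refine ContinuousLinearMap.opNorm_le_bound _ (by positivity) fun z => ?_
  calc ‖f z.1 + g z.2‖ ≤ ‖f‖ * ‖z‖ + ‖g‖ * (2 * ‖z‖) :=
        norm_add_le_of_le (f.le_opNorm_of_le (S.nrm_mono k z.1 z.2))
          (g.le_opNorm_of_le (S.norm_snd_le k z.1 z.2))
    _ = (‖f‖ + 2 * ‖g‖) * ‖z‖ := by ring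

theorem Pair.norm_functional_le_one {c : ℝ}
    (hlower : ∀ (x : X) (y : Y k), ‖x‖ + c * ‖y‖ ≤ S.nrm k (x, y))
    {f : StrongDual ℝ X} {g : StrongDual ℝ (Y k)} (hf : ‖f‖ ≤ 1) (hg : ‖g‖ ≤ c) :
    ‖Pair.functional S k f g‖ ≤ 1 := by
  refine ContinuousLinearMap.opNorm_le_bound _ zero_le_one fun z => ?_
  calc ‖f z.1 + g z.2‖ ≤ 1 * ‖z.1‖ + c * ‖z.2‖ :=
        norm_add_le_of_le (f.le_of_opNorm_le hf _) (g.le_of_opNorm_le hg _)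
    _ ≤ 1 * ‖z‖ := by rw [one_mul, one_mul]; exact hlower z.1 z.2

theorem reflexiveSpace_left [CompleteSpace X] [∀ k, CompleteSpace (Y k)]
    (hsmooth : FrechetSmooth (StrongDual ℝ (S.Pair k))) : ReflexiveSpace X :=
  hsmooth.reflexiveSpace.of_retract (J := Pair.inl S k) (P := Pair.fst S k) fun _ => rfl

theorem reflexiveSpace_right [CompleteSpace X] [∀ k, CompleteSpace (Y k)]
    (hsmooth : FrechetSmooth (StrongDual ℝ (S.Pair k))) : ReflexiveSpace (Y k) :=
  hsmooth.reflexiveSpace.of_retract (J := Pair.inr S k) (P := Pair.snd S k) fun _ => rfl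

end Pair

section Representation

/-- `α` is an admissible sequence of coefficients for the functionals in `Λ`: nonnegative and in
the unit ball of `ℓ²`. -/
structure IsWeight (α : ℕ → ℝ) : Prop where
  nonneg : ∀ k, 0 ≤ α k
  sum_sq_le : ∀ s : Finset ℕ, ∑ k ∈ s, α k ^ 2 ≤ 1

/-- The functional `φ` on the generalized `ℓ²`-sum is `f + ∑ k, α k • g k`, and this expression
shows that it belongs to `Λ`. -/
structure IsRep (φ : StrongDual ℝ S.Sigma) (f : StrongDual ℝ X) (g : ∀ k, StrongDual ℝ (Y k))
    (α : ℕ → ℝ) : Prop where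
  norm_le : ∀ k, ‖Pair.functional S k f (g k)‖ ≤ 1
  weight : IsWeight α
  hasSum : ∀ w : S.Sigma, HasSum (fun k => α k * g k (w.2 k)) (φ w - f w.1)

variable {α : ℕ → ℝ}

theorem IsWeight.summable_sq (hα : IsWeight α) : Summable fun k => α k ^ 2 :=
  summable_of_sum_le (fun k => sq_nonneg (α k)) hα.sum_sq_le

theorem IsWeight.le_one (hα : IsWeight α) (k : ℕ) : α k ≤ 1 := by
  have := hα.sum_sq_le {k}
  rw [Finset.sum_singleton] at this
  exact le_of_abs_le (abs_le_one_iff_mul_self_le_one.2 (by rwa [← sq]))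

variable {S} {f : StrongDual ℝ X} {g : ∀ k, StrongDual ℝ (Y k)} {R : ℝ}

theorem IsWeight.summable_mul_apply (hα : IsWeight α)
    (hg : ∀ k, ‖g k‖ ≤ R) (w : S.Sigma) : Summable fun k => α k * g k (w.2 k) := by
  have hsum : Summable fun k => R * (α k ^ 2 + ‖w.2 k‖ ^ 2) :=
    (hα.summable_sq.add (Sigma.summable_sq S w)).mul_left R
  refine hsum.of_norm_bounded fun k => ?_
  have hR : 0 ≤ R := (norm_nonneg _).trans (hg k)
  calc ‖α k * g k (w.2 k)‖ ≤ α k * (R * ‖w.2 k‖) := by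
        rw [norm_mul, Real.norm_of_nonneg (hα.nonneg k)]
        exact mul_le_mul_of_nonneg_left ((g k).le_of_opNorm_le (hg k) _) (hα.nonneg k)
    _ = R * (α k * ‖w.2 k‖) := by ring
    _ ≤ R * (α k ^ 2 + ‖w.2 k‖ ^ 2) := by
        gcongr
        nlinarith [sq_nonneg (α k - ‖w.2 k‖), sq_nonneg (α k), sq_nonneg ‖w.2 k‖]

theorem exists_mem_Lam (hα : IsWeight α) (hF : ∀ k, ‖Pair.functional S k f (g k)‖ ≤ 1) :
    ∃ φ ∈ S.Lam, ∀ w : S.Sigma, HasSum (fun k => α k * g k (w.2 k)) (φ w - f w.1) := by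
  have hg (k : ℕ) : ‖g k‖ ≤ 1 := (Pair.norm_right_le_norm_functional S f (g k)).trans (hF k)
  have hsum := fun w : S.Sigma => (hα.summable_mul_apply hg w).hasSum
  let φ : S.Sigma →ₗ[ℝ] ℝ :=
    { toFun := fun w => f w.1 + ∑' k, α k * g k (w.2 k)
      map_add' := fun v w => by
        have hadd : ∑' k, α k * g k ((v + w).2 k) =
            ∑' k, α k * g k (v.2 k) + ∑' k, α k * g k (w.2 k) := by
          rw [← (hsum v).summable.tsum_add (hsum w).summable]
          exact tsum_congr fun k => by rw [← mul_add, ← map_add]; rfl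
        rw [hadd, add_add_add_comm, ← map_add]
        rfl
      map_smul' := fun a w => by
        have hsmul : ∑' k, α k * g k ((a • w).2 k) = a * ∑' k, α k * g k (w.2 k) := by
          rw [← tsum_mul_left]
          refine tsum_congr fun k => ?_
          rw [mul_left_comm, ← smul_eq_mul a (g k _), ← map_smul]
          rfl
        rw [hsmul, RingHom.id_apply, smul_eq_mul, mul_add, ← smul_eq_mul a (f _), ← map_smul]
        rfl }
  have hφ (w : S.Sigma) : HasSum (fun k => α k * g k (w.2 k)) (φ w - f w.1) := by
    simpa only [φ, LinearMap.coe_mk, AddHom.coe_mk, add_sub_cancel_left] using hsum w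
  exact ⟨φ, ⟨f, g, α, hF, fun k => ⟨hα.nonneg k, hα.le_one k⟩, ⟨hα.summable_sq,
    hα.summable_sq.tsum_le_of_sum_le hα.sum_sq_le⟩, hφ⟩, hφ⟩

theorem exists_isRep_of_mem_Lam {φ : S.Sigma →ₗ[ℝ] ℝ} (hφ : φ ∈ S.Lam) :
    ∃ ψ f g α, S.IsRep ψ f g α ∧ ∀ w, ψ w = φ w := by
  have ⟨f, g, α, hF, hα, ⟨hsq, htsum⟩, hsum⟩ := hφ
  let ψ : StrongDual ℝ S.Sigma :=
    φ.mkContinuous 1 fun w => by rw [one_mul]; exact Sigma.le_norm S w hφ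
  exact ⟨ψ, f, g, α, ⟨hF, ⟨fun k => (hα k).1,
    fun s => (hsq.sum_le_tsum s fun k _ => sq_nonneg _).trans htsum⟩, hsum⟩, fun _ => rfl⟩

theorem add_hasSum_le_norm (hα : IsWeight α) (hF : ∀ k, ‖Pair.functional S k f (g k)‖ ≤ 1)
    {w : S.Sigma} {a : ℝ} (ha : HasSum (fun k => α k * g k (w.2 k)) a) : f w.1 + a ≤ ‖w‖ := by
  obtain ⟨φ, hφ, hsum⟩ := exists_mem_Lam hα hF
  rw [ha.unique (hsum w), add_sub_cancel]
  exact (le_abs_self _).trans (Sigma.le_norm S w hφ)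

theorem add_hasSum_le_mul_norm (hα : IsWeight α) (hR : 0 < R)
    (hF : ∀ k, ‖Pair.functional S k f (g k)‖ ≤ R) {w : S.Sigma} {a : ℝ}
    (ha : HasSum (fun k => α k * g k (w.2 k)) a) : f w.1 + a ≤ R * ‖w‖ := by
  have hF' (k : ℕ) : ‖Pair.functional S k (R⁻¹ • f) (R⁻¹ • g k)‖ ≤ 1 := by
    rw [Pair.functional_smul, norm_smul, norm_inv, Real.norm_of_nonneg hR.le,
      inv_mul_le_one₀ hR]
    exact hF k
  have hsum : HasSum (fun k => α k * (R⁻¹ • g k) (w.2 k)) (R⁻¹ * a) := by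
    simpa only [smul_apply, smul_eq_mul, mul_left_comm] using ha.mul_left R⁻¹
  have := add_hasSum_le_norm hα hF' hsum
  rwa [smul_apply, smul_eq_mul, ← mul_add, inv_mul_le_iff₀ hR] at this

variable {φ : StrongDual ℝ S.Sigma}

theorem IsRep.apply_le_norm (h : S.IsRep φ f g α) (w : S.Sigma) : φ w ≤ ‖w‖ := by
  simpa using add_hasSum_le_norm h.weight h.norm_le (h.hasSum w)

theorem IsRep.norm_right_le (h : S.IsRep φ f g α) (k : ℕ) : ‖g k‖ ≤ 1 :=
  (Pair.norm_right_le_norm_functional S f (g k)).trans (h.norm_le k)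

theorem IsRep.norm_left_le (h : S.IsRep φ f g α) : ‖f‖ ≤ 1 :=
  (Pair.norm_left_le_norm_functional S f (g 0)).trans (h.norm_le 0)

end Representation

variable {S} {φ : StrongDual ℝ S.Sigma} {f : StrongDual ℝ X} {g : ∀ k, StrongDual ℝ (Y k)}
  {α : ℕ → ℝ}

section Isomorphism

theorem IsRep.abs_apply_le_norm (h : S.IsRep φ f g α) (w : S.Sigma) : |φ w| ≤ ‖w‖ := by
  refine abs_le'.2 ⟨h.apply_le_norm w, ?_⟩
  rw [← map_neg, ← norm_neg w]
  exact h.apply_le_norm (-w)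

theorem IsRep.opNorm_le_one (h : S.IsRep φ f g α) : ‖φ‖ ≤ 1 :=
  φ.opNorm_le_bound zero_le_one fun w => by rw [one_mul]; exact h.abs_apply_le_norm w

theorem IsRep.abs_apply_le (h : S.IsRep φ f g α) (w : S.Sigma) : |φ w| ≤ ‖w.1‖ + ‖w.2‖ := by
  have sum_le (s : Finset ℕ) : |∑ k ∈ s, α k * g k (w.2 k)| ≤ ‖w.2‖ := by
    calc ‖∑ k ∈ s, α k * g k (w.2 k)‖ ≤ ∑ k ∈ s, α k * ‖w.2 k‖ := by
          refine norm_sum_le_of_le _ fun k _ => ?_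
          rw [norm_mul, Real.norm_of_nonneg (h.weight.nonneg k)]
          refine mul_le_mul_of_nonneg_left ?_ (h.weight.nonneg k)
          exact S.abs_right_le k (h.norm_le k) (w.2 k)
      _ ≤ √(∑ k ∈ s, α k ^ 2) * √(∑ k ∈ s, ‖w.2 k‖ ^ 2) := Real.sum_mul_le_sqrt_mul_sqrt s _ _
      _ ≤ 1 * ‖w.2‖ := by
          gcongr
          · exact Real.sqrt_le_one.2 (h.weight.sum_sq_le s)
          · exact (Real.sqrt_le_left (norm_nonneg _)).2 (sum_norm_sq_le_lp_norm_sq w.2 s)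
      _ = ‖w.2‖ := one_mul _
  have abs_tail_le : |φ w - f w.1| ≤ ‖w.2‖ :=
    le_of_tendsto (h.hasSum w).abs (.of_forall sum_le)
  have abs_f_le : |f w.1| ≤ ‖w.1‖ := S.abs_left_le 0 (h.norm_le 0) w.1
  calc |φ w| = |f w.1 + (φ w - f w.1)| := by rw [add_sub_cancel]
    _ ≤ ‖w.1‖ + ‖w.2‖ := (abs_add_le _ _).trans (add_le_add abs_f_le abs_tail_le)

theorem Sigma.norm_le_norm_fst_add_norm_snd (w : S.Sigma) : ‖w‖ ≤ ‖w.1‖ + ‖w.2‖ :=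
  Sigma.norm_le S w fun φ hφ => by
    obtain ⟨ψ, f, g, α, hψ, hψφ⟩ := exists_isRep_of_mem_Lam hφ
    rw [← hψφ]
    exact hψ.abs_apply_le w

variable (S)

/-- The identity of `X × lp Y 2`, as a bounded operator onto the generalized `ℓ²`-sum. -/
noncomputable def Sigma.ofProd : X × lp Y 2 →L[ℝ] S.Sigma :=
  LinearMap.mkContinuous (LinearMap.id : X × lp Y 2 →ₗ[ℝ] X × lp Y 2) 2 fun w => by
    calc ‖(show S.Sigma from w)‖ ≤ ‖w.1‖ + ‖w.2‖ := Sigma.norm_le_norm_fst_add_norm_snd _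
      _ ≤ 2 * ‖w‖ := by linarith [_root_.norm_fst_le w, _root_.norm_snd_le w]

/-- The projection of the generalized `ℓ²`-sum onto `X`. -/
noncomputable def Sigma.fst : S.Sigma →L[ℝ] X :=
  LinearMap.mkContinuous (LinearMap.fst ℝ X (lp Y 2) : S.Sigma →ₗ[ℝ] X) 1
    (fun w => by rw [one_mul]; exact Sigma.norm_fst_le S w)

/-- The projection of the generalized `ℓ²`-sum onto `Y k`. -/
noncomputable def Sigma.coord (k : ℕ) : S.Sigma →L[ℝ] Y k :=
  LinearMap.mkContinuous
    ((lp.evalCLM ℝ Y 2 k).toLinearMap ∘ₗ LinearMap.snd ℝ X (lp Y 2) : S.Sigma →ₗ[ℝ] Y k) 2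
    (fun w => Sigma.norm_snd_le S w k)

variable {S}

theorem IsRep.apply_ofProd_left (h : S.IsRep φ f g α) (x : X) :
    φ (Sigma.ofProd S (x, 0)) = f x := by
  have hsum := h.hasSum (Sigma.ofProd S (x, 0))
  change HasSum (fun k => α k * g k 0) (φ (Sigma.ofProd S (x, 0)) - f x) at hsum
  simp only [map_zero, mul_zero] at hsum
  exact sub_eq_zero.1 (hsum.unique hasSum_zero)

theorem IsRep.apply_ofProd_single (h : S.IsRep φ f g α) (k : ℕ) (y : Y k) :
    φ (Sigma.ofProd S (0, lp.single 2 k y)) = α k * g k y := by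
  have hsum := h.hasSum (Sigma.ofProd S (0, lp.single 2 k y))
  change HasSum (fun j => α j * g j (lp.single 2 k y j)) (φ (Sigma.ofProd S _) - f 0) at hsum
  rw [map_zero, sub_zero] at hsum
  rw [hsum.unique (hasSum_single k fun j hj => by
    rw [lp.single_apply_ne _ _ _ hj, map_zero, mul_zero]), lp.single_apply_self]

theorem isRep_of_apply_ofProd (hF : ∀ k, ‖Pair.functional S k f (g k)‖ ≤ 1) (hα : IsWeight α)
    (hleft : ∀ x, φ (Sigma.ofProd S (x, 0)) = f x)
    (hright : ∀ k y, φ (Sigma.ofProd S (0, lp.single 2 k y)) = α k * g k y) :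
    S.IsRep φ f g α where
  norm_le := hF
  weight := hα
  hasSum w := by
    have hsum := (lp.hasSum_single (p := 2) (by norm_num) w.2).mapL
      (φ ∘L Sigma.ofProd S ∘L ContinuousLinearMap.inr ℝ X (lp Y 2))
    have hw : φ (Sigma.ofProd S (0, w.2)) = φ w - f w.1 := by
      rw [← hleft, ← map_sub φ]
      exact congrArg φ (Prod.ext (sub_self w.1).symm (sub_zero w.2).symm)
    rw [← hw]
    exact hsum.congr_fun fun k => (hright k _).symm

-- The weights proportional to the positive parts `max (g k (w.2 k)) 0` are optimal.
theorem add_sqrt_sum_max_sq_le_norm (hF : ∀ k, ‖Pair.functional S k f (g k)‖ ≤ 1) (w : S.Sigma)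
    (s : Finset ℕ) : f w.1 + √(∑ k ∈ s, max (g k (w.2 k)) 0 ^ 2) ≤ ‖w‖ := by
  set T := √(∑ k ∈ s, max (g k (w.2 k)) 0 ^ 2)
  have hT_sq : T ^ 2 = ∑ k ∈ s, max (g k (w.2 k)) 0 ^ 2 := Real.sq_sqrt (by positivity)
  let β : ℕ → ℝ := fun k => if k ∈ s then max (g k (w.2 k)) 0 / T else 0
  have hβ : IsWeight β := by
    refine ⟨fun k => by dsimp only [β]; split_ifs <;> positivity, fun t => ?_⟩
    calc ∑ k ∈ t, β k ^ 2 = (∑ k ∈ t ∩ s, max (g k (w.2 k)) 0 ^ 2) / T ^ 2 := by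
          rw [Finset.sum_div, ← Finset.sum_ite_mem]
          refine Finset.sum_congr rfl fun k _ => ?_
          dsimp only [β]
          split_ifs
          · exact div_pow _ _ _
          · exact zero_pow two_ne_zero
      _ ≤ T ^ 2 / T ^ 2 := by
          rw [hT_sq]
          gcongr
          exact Finset.inter_subset_right
      _ ≤ 1 := div_self_le_one _
  have hsum : HasSum (fun k => β k * g k (w.2 k)) (∑ k ∈ s, β k * g k (w.2 k)) :=
    hasSum_sum_of_ne_finset_zero fun k hk => by simp only [β, if_neg hk, zero_mul]
  have sum_eq : ∑ k ∈ s, β k * g k (w.2 k) = T := by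
    calc ∑ k ∈ s, β k * g k (w.2 k) = T ^ 2 / T := by
          rw [hT_sq, Finset.sum_div]
          refine Finset.sum_congr rfl fun k hk => ?_
          dsimp only [β]
          rw [if_pos hk]
          rcases le_total (g k (w.2 k)) 0 with h | h
          · simp [max_eq_right h]
          · rw [max_eq_left h]; ring
      _ = T := by rw [sq, mul_self_div_self]
  rw [← sum_eq]
  exact add_hasSum_le_norm hβ hF hsum

theorem norm_fst_add_mul_norm_snd_le {c : ℝ} (hc : 0 < c)
    (hlower : ∀ k (x : X) (y : Y k), ‖x‖ + c * ‖y‖ ≤ S.nrm k (x, y)) (w : S.Sigma) :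
    ‖w.1‖ + c * ‖w.2‖ ≤ ‖w‖ := by
  obtain ⟨f, hf, hfw⟩ := exists_dual_vector'' ℝ w.1
  choose g hg hgw using fun k => exists_dual_vector'' ℝ (w.2 k)
  have hF (k : ℕ) : ‖Pair.functional S k f (c • g k)‖ ≤ 1 := by
    refine Pair.norm_functional_le_one S (hlower k) hf ?_
    rw [norm_smul, Real.norm_of_nonneg hc.le]
    exact mul_le_of_le_one_right hc.le (hg k)
  suffices ‖w.2‖ ≤ (‖w‖ - ‖w.1‖) / c by
    rw [le_div_iff₀' hc] at this
    linarith
  refine lp_norm_le_of_forall_sum_sq_le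
    (div_nonneg (sub_nonneg.2 (Sigma.norm_fst_le S w)) hc.le) fun s => ?_
  have sqrt_le := add_sqrt_sum_max_sq_le_norm hF w s
  have max_eq (k : ℕ) : max ((c • g k) (w.2 k)) 0 = c * ‖w.2 k‖ := by
    rw [smul_apply, hgw]
    exact max_eq_left (by simp only [Real.ringHom_apply, smul_eq_mul]; positivity)
  simp only [max_eq, hfw, mul_pow, ← Finset.mul_sum] at sqrt_le
  rw [div_pow, le_div_iff₀' (by positivity)]
  refine Real.sqrt_le_left ?_ |>.1 (le_sub_iff_add_le'.2 sqrt_le)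
  exact sub_nonneg.2 (Sigma.norm_fst_le S w)

theorem reflexiveSpace_sigma (hX : ReflexiveSpace X) (hY : ∀ k, ReflexiveSpace (Y k)) {c : ℝ}
    (hc : 0 < c) (hlower : ∀ k (x : X) (y : Y k), ‖x‖ + c * ‖y‖ ≤ S.nrm k (x, y)) :
    ReflexiveSpace S.Sigma := by
  let snd : S.Sigma →L[ℝ] lp Y 2 :=
    LinearMap.mkContinuous (LinearMap.snd ℝ X (lp Y 2) : S.Sigma →ₗ[ℝ] lp Y 2) c⁻¹ fun w => by
      have := norm_fst_add_mul_norm_snd_le hc hlower w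
      rw [le_inv_mul_iff₀ hc]
      exact (le_add_of_nonneg_left (norm_nonneg w.1)).trans this
  exact (hX.prod (ReflexiveSpace.lp_two hY)).of_retract (J := (Sigma.fst S).prod snd)
    (P := Sigma.ofProd S) fun _ => rfl

end Isomorphism

section Attainment

theorem IsRep.neg (h : S.IsRep φ f g α) : S.IsRep (-φ) (-f) (fun k => -g k) α where
  norm_le k := by
    rw [← neg_one_smul ℝ f, ← neg_one_smul ℝ (g k), Pair.functional_smul, norm_smul]
    simpa using h.norm_le k
  weight := h.weight
  hasSum w := by
    have hsum := (h.hasSum w).neg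
    rw [neg_sub'] at hsum
    exact hsum.congr_fun fun k => mul_neg _ _

theorem exists_isRep_lt_apply (z : S.Sigma) {δ : ℝ} (hδ : 0 < δ) :
    ∃ φ f g α, S.IsRep φ f g α ∧ ‖z‖ - δ < φ z := by
  have hne : {r : ℝ | ∃ φ ∈ S.Lam, r = |φ z|}.Nonempty := ⟨_, 0, S.zero_mem_Lam, rfl⟩
  obtain ⟨_, ⟨φ₀, hφ₀, rfl⟩, hlt⟩ := exists_lt_of_lt_csSup hne (sub_lt_self ‖z‖ hδ)
  obtain ⟨φ, f, g, α, h, hφ⟩ := exists_isRep_of_mem_Lam hφ₀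
  rw [← hφ] at hlt
  rcases le_total 0 (φ z) with hz | hz
  · exact ⟨φ, f, g, α, h, by rwa [abs_of_nonneg hz] at hlt⟩
  · exact ⟨-φ, -f, fun k => -g k, α, h.neg, by rwa [abs_of_nonpos hz] at hlt⟩

theorem exists_isRep_pointwise_limit {ι : Type*} (U : Ultrafilter ι) {φ : ι → StrongDual ℝ S.Sigma}
    {f : ι → StrongDual ℝ X} {g : ι → ∀ k, StrongDual ℝ (Y k)} {α : ι → ℕ → ℝ}
    (h : ∀ i, S.IsRep (φ i) (f i) (g i) (α i)) :
    ∃ ψ f₀ g₀ α₀, S.IsRep ψ f₀ g₀ α₀ ∧ ∀ w, Tendsto (fun i => φ i w) U (𝓝 (ψ w)) := by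
  obtain ⟨ψ, -, hψ⟩ := exists_pointwise_limit U (.of_forall fun i => (h i).opNorm_le_one)
  obtain ⟨f₀, -, hf⟩ := exists_pointwise_limit U (.of_forall fun i => (h i).norm_left_le)
  choose g₀ _ hg using fun k =>
    exists_pointwise_limit U (f := fun i => g i k) (.of_forall fun i => (h i).norm_right_le k)
  have exists_limit (k : ℕ) : ∃ a, Tendsto (fun i => α i k) U (𝓝 a) := by
    obtain ⟨a, -, ha⟩ := isCompact_Icc.ultrafilter_le_nhds (U.map fun i => α i k)
      (le_principal_iff.2 (Filter.mem_map.2 (univ_mem' fun i =>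
        ⟨(h i).weight.nonneg k, (h i).weight.le_one k⟩)))
    exact ⟨a, ha⟩
  choose α₀ hα using exists_limit
  refine ⟨ψ, f₀, g₀, α₀, isRep_of_apply_ofProd (fun k => ?_) ⟨fun k => ?_, fun s => ?_⟩
    (fun x => ?_) (fun k y => ?_), hψ⟩
  · refine ContinuousLinearMap.opNorm_le_bound _ zero_le_one fun w => ?_
    exact le_of_tendsto ((hf w.1).add (hg k w.2)).norm (.of_forall fun i =>
      (Pair.functional S k (f i) (g i k)).le_of_opNorm_le ((h i).norm_le k) w)
  · exact ge_of_tendsto (hα k) (.of_forall fun i => (h i).weight.nonneg k)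
  · exact le_of_tendsto (tendsto_finsetSum s fun k _ => (hα k).pow 2)
      (.of_forall fun i => (h i).weight.sum_sq_le s)
  · refine tendsto_nhds_unique (hψ _) ((hf x).congr fun i => ?_)
    exact ((h i).apply_ofProd_left x).symm
  · refine tendsto_nhds_unique (hψ _) (((hα k).mul (hg k y)).congr fun i => ?_)
    exact ((h i).apply_ofProd_single k y).symm

theorem exists_isRep_apply_eq_norm (z : S.Sigma) :
    ∃ φ f g α, S.IsRep φ f g α ∧ φ z = ‖z‖ := by
  choose φ f g α h hlt using fun n : ℕ =>
    exists_isRep_lt_apply z (Nat.one_div_pos_of_nat (α := ℝ) (n := n))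
  obtain ⟨ψ, f₀, g₀, α₀, hψ, hlim⟩ := exists_isRep_pointwise_limit (hyperfilter ℕ) h
  refine ⟨ψ, f₀, g₀, α₀, hψ, (hψ.apply_le_norm z).antisymm ?_⟩
  have tendsto_norm : Tendsto (fun n : ℕ => ‖z‖ - 1 / ((n : ℝ) + 1)) (hyperfilter ℕ) (𝓝 ‖z‖) := by
    simpa using (tendsto_one_div_add_atTop_nhds_zero_nat.mono_left
      Nat.hyperfilter_le_atTop).const_sub ‖z‖
  exact le_of_tendsto_of_tendsto tendsto_norm (hlim z) (.of_forall fun n => (hlt n).le)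

end Attainment

/-! ### Perturbing a functional of `Λ` -/

section Perturbation

theorem IsRep.sum_apply_le (h : S.IsRep φ f g α) {w : S.Sigma} (hw : ‖w‖ ≤ 1) {τ : ℝ}
    (hτ : 0 ≤ τ) {t : Finset ℕ} (ht : ∑ k ∈ t, α k ^ 2 ≤ τ ^ 2) :
    ∑ k ∈ t, α k * g k (w.2 k) ≤ 2 * τ := by
  have abs_le_one : |f w.1| ≤ 1 :=
    (S.abs_left_le 0 (h.norm_le 0) w.1).trans ((Sigma.norm_fst_le S w).trans hw)
  calc ∑ k ∈ t, α k * g k (w.2 k) ≤ ∑ k ∈ t, α k * max (g k (w.2 k)) 0 :=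
        Finset.sum_le_sum fun k _ =>
          mul_le_mul_of_nonneg_left (le_max_left _ _) (h.weight.nonneg k)
    _ ≤ √(∑ k ∈ t, α k ^ 2) * √(∑ k ∈ t, max (g k (w.2 k)) 0 ^ 2) :=
        Real.sum_mul_le_sqrt_mul_sqrt t _ _
    _ ≤ τ * 2 := by
        gcongr
        · exact (Real.sqrt_le_left hτ).2 ht
        · linarith [add_sqrt_sum_max_sq_le_norm h.norm_le w t, (abs_le.1 abs_le_one).1]
    _ = 2 * τ := mul_comm _ _

theorem IsRep.apply_sub_sum_le (h : S.IsRep φ f g α) {w : S.Sigma} (hw : ‖w‖ ≤ 1) {τ : ℝ}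
    (hτ : 0 ≤ τ) {K : Finset ℕ} (hK : ∀ t, Disjoint t K → ∑ k ∈ t, α k ^ 2 ≤ τ ^ 2) :
    φ w - f w.1 - ∑ k ∈ K, α k * g k (w.2 k) ≤ 2 * τ := by
  refine le_of_tendsto ((h.hasSum w).sub_const (∑ k ∈ K, α k * g k (w.2 k))) ?_
  filter_upwards [eventually_ge_atTop K] with s hs
  rw [sub_le_iff_le_add, ← Finset.sum_sdiff hs]
  gcongr
  exact h.sum_apply_le hw hτ (hK _ Finset.sdiff_disjoint)

-- This is the convex combination of `f + g` and `f + η₁ • f'` with weights `1 - η / η₁`, `η / η₁`.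
theorem Pair.norm_functional_convexComb_le {k : ℕ} {f f' : StrongDual ℝ X}
    {g : StrongDual ℝ (Y k)} (hF : ‖Pair.functional S k f g‖ ≤ 1) {η η₁ δ : ℝ} (hη : 0 < η)
    (hη₁ : η ≤ η₁) (hf' : ‖f + η₁ • f'‖ ≤ 1 + δ * η₁) :
    ‖Pair.functional S k (f + η • f') ((1 - η / η₁) • g)‖ ≤ 1 + δ * η := by
  have hη₁_pos : 0 < η₁ := hη.trans_le hη₁
  have hle : η / η₁ ≤ 1 := (div_le_one hη₁_pos).2 hη₁
  have functional_eq : Pair.functional S k (f + η • f') ((1 - η / η₁) • g) =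
      (1 - η / η₁) • Pair.functional S k f g +
        (η / η₁) • Pair.functional S k (f + η₁ • f') 0 := by
    ext z
    simp only [Pair.functional_apply, add_apply, smul_apply, smul_eq_mul, zero_apply]
    field_simp
    ring
  calc ‖Pair.functional S k (f + η • f') ((1 - η / η₁) • g)‖
      ≤ (1 - η / η₁) * ‖Pair.functional S k f g‖ + η / η₁ * ‖f + η₁ • f'‖ := by
        rw [functional_eq, ← Pair.norm_functional_zero_right S (k := k) (f + η₁ • f')]
        refine norm_add_le_of_le ?_ ?_
        · rw [norm_smul, Real.norm_of_nonneg (sub_nonneg.2 hle)]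
        · rw [norm_smul, Real.norm_of_nonneg (by positivity)]
    _ ≤ (1 - η / η₁) * 1 + η / η₁ * (1 + δ * η₁) := by
        have := sub_nonneg.2 hle
        gcongr
    _ = 1 + δ * η := by field_simp; ring

theorem IsRep.add_sum_le_of_norm_le (h : S.IsRep φ f g α) {w : S.Sigma} (hw : ‖w‖ ≤ 1)
    {f' : StrongDual ℝ X} {g' : ∀ k, StrongDual ℝ (Y k)} {η η₁ δ : ℝ} (hδ : 0 < δ) (hη : 0 < η)
    (hη₁ : η ≤ η₁) (hf' : ‖f + η₁ • f'‖ ≤ 1 + δ * η₁) {K : Finset ℕ}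
    (hK : ∀ t, Disjoint t K → ∑ k ∈ t, α k ^ 2 ≤ (δ * η₁) ^ 2)
    (hg' : ∀ k ∈ K, α k ≠ 0 →
      ‖Pair.functional S k f (g k) + η • Pair.functional S k f' (g' k)‖ ≤ 1 + δ * η) :
    f' w.1 + ∑ k ∈ K, α k * g' k (w.2 k) ≤ (1 - φ w) / η + 3 * δ := by
  have hη₁_pos : 0 < η₁ := hη.trans_le hη₁
  let G (k : ℕ) : StrongDual ℝ (Y k) :=
    if k ∈ K ∧ α k ≠ 0 then g k + η • g' k else (1 - η / η₁) • g k
  have norm_G_le (k : ℕ) : ‖Pair.functional S k (f + η • f') (G k)‖ ≤ 1 + δ * η := by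
    by_cases hk : k ∈ K ∧ α k ≠ 0
    · simpa only [G, if_pos hk, Pair.functional_add_smul] using hg' k hk.1 hk.2
    · simpa only [G, if_neg hk] using Pair.norm_functional_convexComb_le (h.norm_le k) hη hη₁ hf'
  have hasSum_G : HasSum (fun k => α k * G k (w.2 k)) ((1 - η / η₁) * (φ w - f w.1) +
      ∑ k ∈ K, (α k * G k (w.2 k) - (1 - η / η₁) * (α k * g k (w.2 k)))) := by
    refine (((h.hasSum w).mul_left _).add
      (hasSum_sum_of_ne_finset_zero fun k hk => ?_)).congr_fun fun k => (add_sub_cancel _ _).symm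
    simp only [G, hk, false_and, if_false, smul_apply, smul_eq_mul]
    ring
  have sum_eq : ∑ k ∈ K, (α k * G k (w.2 k) - (1 - η / η₁) * (α k * g k (w.2 k))) =
      η * ∑ k ∈ K, α k * g' k (w.2 k) + η / η₁ * ∑ k ∈ K, α k * g k (w.2 k) := by
    rw [Finset.mul_sum, Finset.mul_sum, ← Finset.sum_add_distrib]
    refine Finset.sum_congr rfl fun k hk => ?_
    by_cases hαk : α k = 0
    · simp [hαk]
    · simp only [G, hk, hαk, ne_eq, not_false_eq_true, and_self, if_true, add_apply, smul_apply,
        smul_eq_mul]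
      ring
  have value_le : (f + η • f') w.1 + _ ≤ 1 + δ * η :=
    (add_hasSum_le_mul_norm h.weight (by positivity) norm_G_le hasSum_G).trans
      (mul_le_of_le_one_right (by positivity) hw)
  have tail_le := mul_le_mul_of_nonneg_left (h.apply_sub_sum_le hw (by positivity) hK)
    (by positivity : 0 ≤ η / η₁)
  rw [sum_eq, add_apply, smul_apply, smul_eq_mul] at value_le
  have ratio_mul : η / η₁ * (2 * (δ * η₁)) = 2 * (δ * η) := by field_simp
  rw [← sub_le_iff_le_add, le_div_iff₀ hη]
  linarith

theorem IsWeight.exists_finset_sum_sq_le (h : IsWeight α) {ε : ℝ} (hε : 0 < ε) :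
    ∃ K : Finset ℕ, ∀ t, Disjoint t K → ∑ k ∈ t, α k ^ 2 ≤ ε := by
  obtain ⟨K, hK⟩ := summable_iff_vanishing_norm.1 h.summable_sq ε hε
  exact ⟨K, fun t ht => (le_abs_self _).trans (hK t ht).le⟩

variable {ι : Type*} {l : Filter ι} {w : ι → S.Sigma}

theorem IsRep.eventually_add_sum_le (h : S.IsRep φ f g α) (hw : ∀ᶠ i in l, ‖w i‖ ≤ 1)
    (hφ : Tendsto (fun i => φ (w i)) l (𝓝 1)) {f' : ι → StrongDual ℝ X}
    {g' : ι → ∀ k, StrongDual ℝ (Y k)} (hf' : IsTangent l f f')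
    (hg' : ∀ k, α k ≠ 0 →
      IsTangent l (Pair.functional S k f (g k)) fun i => Pair.functional S k (f' i) (g' i k))
    {ε : ℝ} (hε : 0 < ε) :
    ∀ᶠ K in atTop, ∀ᶠ i in l, f' i (w i).1 + ∑ k ∈ K, α k * g' i k ((w i).2 k) ≤ ε := by
  obtain ⟨η₁, hη₁, hη₁_pos : 0 < η₁⟩ :=
    ((hf' (ε / 4) (by positivity)).and self_mem_nhdsWithin).exists
  obtain ⟨K₀, hK₀⟩ := h.weight.exists_finset_sum_sq_le (by positivity : 0 < (ε / 4 * η₁) ^ 2)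
  filter_upwards [eventually_ge_atTop K₀] with K hK
  have eventually_tangent : ∀ᶠ η : ℝ in 𝓝[>] 0, ∀ k ∈ K, α k ≠ 0 → ∀ᶠ i in l,
      ‖Pair.functional S k f (g k) + η • Pair.functional S k (f' i) (g' i k)‖ ≤ 1 + ε / 4 * η :=
    (Filter.eventually_all_finset K).2 fun k _ => by
      by_cases hαk : α k = 0
      · exact .of_forall fun η hk => absurd hαk hk
      · exact (hg' k hαk _ (by positivity)).mono fun η hη _ => hη
  obtain ⟨η, ⟨hη_tangent, hη_le⟩, hη_pos : 0 < η⟩ := ((eventually_tangent.and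
    (eventually_nhdsGT_zero_mul_le 1 hη₁_pos)).and self_mem_nhdsWithin).exists
  have eventually_tangent_all : ∀ᶠ i in l, ∀ k ∈ K, α k ≠ 0 →
      ‖Pair.functional S k f (g k) + η • Pair.functional S k (f' i) (g' i k)‖ ≤ 1 + ε / 4 * η :=
    (Filter.eventually_all_finset K).2 fun k hk => by
      by_cases hαk : α k = 0
      · exact .of_forall fun i hk' => absurd hαk hk'
      · exact (hη_tangent k hk hαk).mono fun i hi _ => hi
  filter_upwards [hw, hη₁, eventually_tangent_all, hφ.eventually_const_le
    (sub_lt_self 1 (by positivity : 0 < ε / 4 * η))] with i hwi hf'i hg'i hφi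
  have le := h.add_sum_le_of_norm_le hwi (by positivity) hη_pos (by rwa [mul_one] at hη_le) hf'i
    (fun t ht => hK₀ t (ht.mono_right hK)) hg'i
  have : (1 - φ (w i)) / η ≤ ε / 4 := by rw [div_le_iff₀ hη_pos]; linarith
  linarith

end Perturbation

section AlmostNorming

theorem sum_max_sub_sq_le (hα : IsWeight α) (hF : ∀ k, ‖Pair.functional S k f (g k)‖ ≤ 1)
    {w : S.Sigma} (hw : ‖w‖ ≤ 1) {a : ℝ} (ha : HasSum (fun k => α k * g k (w.2 k)) a)
    (s : Finset ℕ) :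
    ∑ k ∈ s, (max (g k (w.2 k)) 0 - (1 - f w.1) * α k) ^ 2 ≤
      2 * (1 - f w.1) * (1 - f w.1 - a) := by
  set b := 1 - f w.1
  have sqrt_le (t : Finset ℕ) : √(∑ k ∈ t, max (g k (w.2 k)) 0 ^ 2) ≤ b := by
    linarith [add_sqrt_sum_max_sq_le_norm hF w t]
  have hb_nonneg : 0 ≤ b := (Real.sqrt_nonneg _).trans (sqrt_le ∅)
  refine ge_of_tendsto ((ha.const_sub b).const_mul (2 * b)) ?_
  filter_upwards [eventually_ge_atTop s] with t ht
  calc ∑ k ∈ s, (max (g k (w.2 k)) 0 - b * α k) ^ 2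
      ≤ ∑ k ∈ t, (max (g k (w.2 k)) 0 - b * α k) ^ 2 :=
        Finset.sum_le_sum_of_subset_of_nonneg ht fun k _ _ => sq_nonneg _
    _ = ∑ k ∈ t, max (g k (w.2 k)) 0 ^ 2 + b ^ 2 * ∑ k ∈ t, α k ^ 2 -
          2 * b * ∑ k ∈ t, α k * max (g k (w.2 k)) 0 := by
        simp only [Finset.mul_sum, ← Finset.sum_add_distrib, ← Finset.sum_sub_distrib]
        exact Finset.sum_congr rfl fun k _ => by ring
    _ ≤ b ^ 2 + b ^ 2 * 1 - 2 * b * ∑ k ∈ t, α k * g k (w.2 k) := by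
        gcongr with k
        · exact (Real.sqrt_le_left hb_nonneg).1 (sqrt_le t)
        · exact hα.sum_sq_le t
        · exact hα.nonneg k
        · exact le_max_left _ _
    _ = 2 * b * (b - ∑ k ∈ t, α k * g k (w.2 k)) := by ring

theorem sum_max_sq_le (hα : IsWeight α) (hF : ∀ k, ‖Pair.functional S k f (g k)‖ ≤ 1)
    {w : S.Sigma} (hw : ‖w‖ ≤ 1) {a : ℝ} (ha : HasSum (fun k => α k * g k (w.2 k)) a)
    (s : Finset ℕ) :
    ∑ k ∈ s, max (g k (w.2 k)) 0 ^ 2 ≤ 8 * (1 - f w.1 - a) + 8 * ∑ k ∈ s, α k ^ 2 := by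
  have abs_le_one : |f w.1| ≤ 1 :=
    (S.abs_left_le 0 (hF 0) w.1).trans ((Sigma.norm_fst_le S w).trans hw)
  have gap_nonneg : 0 ≤ 1 - f w.1 - a := by linarith [add_hasSum_le_norm hα hF ha]
  set b := 1 - f w.1
  have sq_le_four : b ^ 2 ≤ 4 := by nlinarith [abs_le.1 abs_le_one]
  calc ∑ k ∈ s, max (g k (w.2 k)) 0 ^ 2
      ≤ ∑ k ∈ s, (2 * (max (g k (w.2 k)) 0 - b * α k) ^ 2 + 2 * (b ^ 2 * α k ^ 2)) :=
        Finset.sum_le_sum fun k _ => by nlinarith [sq_nonneg (max (g k (w.2 k)) 0 - 2 * (b * α k))]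
    _ = 2 * ∑ k ∈ s, (max (g k (w.2 k)) 0 - b * α k) ^ 2 + 2 * (b ^ 2 * ∑ k ∈ s, α k ^ 2) := by
        simp only [Finset.sum_add_distrib, Finset.mul_sum]
    _ ≤ 2 * (2 * b * (b - a)) + 2 * (4 * ∑ k ∈ s, α k ^ 2) := by
        gcongr
        exact sum_max_sub_sq_le hα hF hw ha s
    _ ≤ 2 * (2 * 2 * (b - a)) + 2 * (4 * ∑ k ∈ s, α k ^ 2) := by
        gcongr
        linarith [(abs_le.1 abs_le_one).1]
    _ = 8 * (b - a) + 8 * ∑ k ∈ s, α k ^ 2 := by ring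

-- On `t`, where `α` is small, replace `g` by `c` times norming functionals of `w.2`.
theorem IsRep.mul_sum_norm_sq_le (h : S.IsRep φ f g α) {c : ℝ} (hc : 0 ≤ c)
    (hlower : ∀ k (x : X) (y : Y k), ‖x‖ + c * ‖y‖ ≤ S.nrm k (x, y)) {w : S.Sigma}
    (hw : ‖w‖ ≤ 1) {τ : ℝ} (hτ : 0 ≤ τ) {t : Finset ℕ} (ht : ∑ k ∈ t, α k ^ 2 ≤ τ ^ 2) :
    c ^ 2 * ∑ k ∈ t, ‖w.2 k‖ ^ 2 ≤ 8 * (1 - φ w) + 16 * τ + 8 * τ ^ 2 := by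
  choose e norm_e_le e_apply using fun k => exists_dual_vector'' ℝ (w.2 k)
  let G (k : ℕ) : StrongDual ℝ (Y k) := if k ∈ t then c • e k else g k
  have norm_G_le (k : ℕ) : ‖Pair.functional S k f (G k)‖ ≤ 1 := by
    by_cases hk : k ∈ t
    · refine Pair.norm_functional_le_one S (hlower k) h.norm_left_le ?_
      simp only [G, if_pos hk]
      rw [norm_smul, Real.norm_of_nonneg hc]
      exact mul_le_of_le_one_right hc (norm_e_le k)
    · simpa only [G, if_neg hk] using h.norm_le k
  have G_apply {k : ℕ} (hk : k ∈ t) : G k (w.2 k) = c * ‖w.2 k‖ := by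
    simp only [G, if_pos hk, smul_apply, smul_eq_mul, e_apply, RCLike.ofReal_real_eq_id, id_eq]
  have hasSum_G : HasSum (fun k => α k * G k (w.2 k)) (φ w - f w.1 +
      ∑ k ∈ t, (α k * G k (w.2 k) - α k * g k (w.2 k))) := by
    refine ((h.hasSum w).add (hasSum_sum_of_ne_finset_zero fun k hk => ?_)).congr_fun
      fun k => (add_sub_cancel _ _).symm
    simp only [G, if_neg hk, sub_self]
  have replaced_ge : -(2 * τ) ≤ ∑ k ∈ t, (α k * G k (w.2 k) - α k * g k (w.2 k)) := by
    rw [Finset.sum_sub_distrib]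
    have : 0 ≤ ∑ k ∈ t, α k * G k (w.2 k) := Finset.sum_nonneg fun k hk => by
      rw [G_apply hk]
      exact mul_nonneg (h.weight.nonneg k) (by positivity)
    linarith [h.sum_apply_le hw hτ ht]
  calc c ^ 2 * ∑ k ∈ t, ‖w.2 k‖ ^ 2 = ∑ k ∈ t, max (G k (w.2 k)) 0 ^ 2 := by
        rw [Finset.mul_sum]
        refine Finset.sum_congr rfl fun k hk => ?_
        rw [G_apply hk, max_eq_left (by positivity), mul_pow]
    _ ≤ 8 * (1 - φ w) + 16 * τ + 8 * τ ^ 2 := by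
        linarith [sum_max_sq_le h.weight norm_G_le hw hasSum_G t]

end AlmostNorming

section Tangents

theorem frechetSmooth_dual_left {k : ℕ} (hsmooth : FrechetSmooth (StrongDual ℝ (S.Pair k))) :
    FrechetSmooth (StrongDual ℝ X) := by
  intro f hf
  let L : StrongDual ℝ X →L[ℝ] StrongDual ℝ (S.Pair k) :=
    ContinuousLinearMap.precomp ℝ (Pair.fst S k)
  have norm_L (f : StrongDual ℝ X) : ‖L f‖ = ‖f‖ := by
    rw [← Pair.norm_functional_zero_right S (k := k) f]
    congr 1
    ext z
    exact (add_zero _).symm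
  have := (hsmooth (L f) (norm_ne_zero_iff.1 (norm_L f ▸ norm_ne_zero_iff.2 hf))).comp f
    L.differentiableAt
  simpa only [Function.comp_def, norm_L] using this

variable {ι : Type*} {l : Filter ι} {w : ι → S.Sigma}

theorem IsRep.eventually_apply_fst_le (h : S.IsRep φ f g α) (hw : ∀ᶠ i in l, ‖w i‖ ≤ 1)
    (hφ : Tendsto (fun i => φ (w i)) l (𝓝 1)) {f' : ι → StrongDual ℝ X} (hf' : IsTangent l f f')
    (hg' : ∀ k, α k ≠ 0 →
      IsTangent l (Pair.functional S k f (g k)) fun i => Pair.functional S k (f' i) 0)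
    {ε : ℝ} (hε : 0 < ε) : ∀ᶠ i in l, f' i (w i).1 ≤ ε := by
  obtain ⟨K, hK⟩ := (h.eventually_add_sum_le hw hφ (g' := fun _ _ => 0) hf' hg' hε).exists
  simpa only [zero_apply, mul_zero, Finset.sum_const_zero, add_zero] using hK

theorem IsRep.eventually_apply_snd_le (h : S.IsRep φ f g α) (hw : ∀ᶠ i in l, ‖w i‖ ≤ 1)
    (hφ : Tendsto (fun i => φ (w i)) l (𝓝 1)) {k : ℕ} (hαk : α k ≠ 0)
    {g' : ι → StrongDual ℝ (Y k)}
    (hg' : IsTangent l (Pair.functional S k f (g k)) fun i => Pair.functional S k 0 (g' i))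
    {ε : ℝ} (hε : 0 < ε) : ∀ᶠ i in l, g' i ((w i).2 k) ≤ ε := by
  have hαk_pos : 0 < α k := (h.weight.nonneg k).lt_of_ne' hαk
  have isTangent_single (j : ℕ) (_ : α j ≠ 0) :
      IsTangent l (Pair.functional S j f (g j)) fun i =>
        Pair.functional S j 0 (Pi.single (M := fun k => StrongDual ℝ (Y k)) k (g' i) j) := by
    rcases eq_or_ne j k with rfl | hj
    · simpa only [Pi.single_eq_same] using hg'
    · simpa only [Pi.single_eq_of_ne hj, Pair.functional_zero] using isTangent_zero (h.norm_le j)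
  obtain ⟨K, hK, hkK⟩ := ((h.eventually_add_sum_le hw hφ (isTangent_zero h.norm_left_le)
    isTangent_single (by positivity : 0 < α k * ε)).and (eventually_ge_atTop {k})).exists
  filter_upwards [hK] with i hi
  rw [zero_apply, zero_add, Finset.sum_eq_single_of_mem k (hkK (by simp))
    fun j _ hj => by rw [Pi.single_eq_of_ne hj, zero_apply, mul_zero], Pi.single_eq_same] at hi
  exact le_of_mul_le_mul_left hi hαk_pos

end Tangents

/-! ### Strict convexity -/

section NormingPoint

variable {z : S.Sigma}

theorem IsRep.hasSum_of_isTangentLine (h : S.IsRep φ f g α) (hz : ‖z‖ ≤ 1) (hφz : φ z = 1)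
    {f' : StrongDual ℝ X} {g' : ∀ k, StrongDual ℝ (Y k)} (hf' : IsTangentLine f f')
    (hg' : ∀ k, α k ≠ 0 →
      IsTangentLine (Pair.functional S k f (g k)) (Pair.functional S k f' (g' k))) :
    HasSum (fun k => α k * g' k (z.2 k)) (-f' z.1) := by
  have eventually_le (a : ℝ) {ε : ℝ} (hε : 0 < ε) :
      ∀ᶠ K in atTop, a * (f' z.1 + ∑ k ∈ K, α k * g' k (z.2 k)) ≤ ε := by
    have hg'_smul (k : ℕ) (hk : α k ≠ 0) : IsTangent (pure ()) (Pair.functional S k f (g k))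
        fun _ => Pair.functional S k (a • f') (a • g' k) := by
      simpa only [Pair.functional_smul] using hg' k hk a
    filter_upwards [h.eventually_add_sum_le (w := fun _ => z) (.of_forall fun _ => hz)
      (tendsto_const_nhds_iff.2 hφz) (hf' a) hg'_smul hε] with K hK
    simpa only [eventually_pure, smul_apply, smul_eq_mul, mul_left_comm _ a, ← Finset.mul_sum,
      ← mul_add] using hK
  refine tendsto_iff_norm_sub_tendsto_zero.2 (nhds_basis_closedBall.tendsto_right_iff.2 ?_)
  intro ε hε
  filter_upwards [eventually_le 1 hε, eventually_le (-1) hε] with K hle hneg_le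
  rw [mem_closedBall_zero_iff, norm_norm, Real.norm_eq_abs, abs_le]
  constructor <;> linarith

theorem IsRep.apply_snd_eq_zero (h : S.IsRep φ f g α) (hz : ‖z‖ ≤ 1) (hφz : φ z = 1) {k : ℕ}
    (hαk : α k ≠ 0) {g' : StrongDual ℝ (Y k)}
    (hg' : IsTangentLine (Pair.functional S k f (g k)) (Pair.functional S k 0 g')) :
    g' (z.2 k) = 0 := by
  have mul_nonpos (a : ℝ) : a * g' (z.2 k) ≤ 0 := by
    refine le_of_forall_pos_le_add fun ε hε => ?_
    have hg'_smul : IsTangent (pure ()) (Pair.functional S k f (g k))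
        fun _ => Pair.functional S k 0 (a • g') := by
      simpa only [← Pair.functional_smul, smul_zero] using hg' a
    rw [zero_add]
    exact h.eventually_apply_snd_le (w := fun _ => z) (.of_forall fun _ => hz)
      (tendsto_const_nhds_iff.2 hφz) hαk hg'_smul hε
  linarith [mul_nonpos 1, mul_nonpos (-1)]

theorem IsRep.max_apply_snd_eq (h : S.IsRep φ f g α) (hz : ‖z‖ ≤ 1) (hφz : φ z = 1) (k : ℕ) :
    max (g k (z.2 k)) 0 = (1 - f z.1) * α k := by
  have := sum_max_sub_sq_le h.weight h.norm_le hz (h.hasSum z) {k}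
  rw [Finset.sum_singleton, hφz, sub_self, mul_zero] at this
  exact sub_eq_zero.1 (pow_eq_zero_iff two_ne_zero |>.1 (this.antisymm (sq_nonneg _)))

theorem IsRep.snd_eq_zero (h : S.IsRep φ f g α) {c : ℝ} (hc : 0 < c)
    (hlower : ∀ k (x : X) (y : Y k), ‖x‖ + c * ‖y‖ ≤ S.nrm k (x, y)) (hz : ‖z‖ ≤ 1)
    (hφz : φ z = 1) {k : ℕ} (hαk : α k = 0) : z.2 k = 0 := by
  have := h.mul_sum_norm_sq_le hc.le hlower hz le_rfl (t := {k}) (by simp [hαk])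
  rw [Finset.sum_singleton, hφz] at this
  have : ‖z.2 k‖ ^ 2 ≤ 0 := nonpos_of_mul_nonpos_right (by linarith) (by positivity : 0 < c ^ 2)
  exact norm_eq_zero.1 (pow_eq_zero_iff two_ne_zero |>.1 (this.antisymm (sq_nonneg _)))

end NormingPoint

section LeftNormLtOne

variable {z : S.Sigma}

theorem apply_fst_lt_one (hf : ‖f‖ < 1) (hz : ‖z‖ ≤ 1) : f z.1 < 1 := by
  calc f z.1 ≤ ‖f‖ * ‖z.1‖ := (le_abs_self _).trans (f.le_opNorm _)
    _ ≤ ‖f‖ * 1 := by gcongr; exact (Sigma.norm_fst_le S z).trans hz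
    _ < 1 := by rwa [mul_one]

theorem IsRep.apply_snd_eq (h : S.IsRep φ f g α) (hf : ‖f‖ < 1) (hz : ‖z‖ ≤ 1) (hφz : φ z = 1)
    {k : ℕ} (hαk : α k ≠ 0) : g k (z.2 k) = (1 - f z.1) * α k := by
  have hpos : 0 < (1 - f z.1) * α k :=
    mul_pos (sub_pos.2 (apply_fst_lt_one hf hz)) ((h.weight.nonneg k).lt_of_ne' hαk)
  have hmax := h.max_apply_snd_eq hz hφz k
  rwa [max_eq_left (lt_max_iff.1 (hmax ▸ hpos) |>.resolve_right (lt_irrefl 0)).le] at hmax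

variable {k : ℕ} {u : S.Pair k}

theorem IsRep.apply_tangent_snd_ne_zero (h : S.IsRep φ f g α) (hf : ‖f‖ < 1) (hz : ‖z‖ ≤ 1)
    (hφz : φ z = 1) (hαk : α k ≠ 0)
    (hu : ∀ F, F u = 0 → IsTangentLine (Pair.functional S k f (g k)) F) : g k u.2 ≠ 0 := by
  intro hgu
  have apply_eq_zero := h.apply_snd_eq_zero hz hφz hαk (hu (Pair.functional S k 0 (g k)) (by
    rw [Pair.functional_apply, zero_apply, zero_add, hgu]))
  rw [h.apply_snd_eq hf hz hφz hαk] at apply_eq_zero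
  exact mul_ne_zero (sub_ne_zero.2 (apply_fst_lt_one hf hz).ne') hαk apply_eq_zero

theorem IsRep.apply_snd_eq_mul_div (h : S.IsRep φ f g α) (hf : ‖f‖ < 1) (hz : ‖z‖ ≤ 1)
    (hφz : φ z = 1) (hαk : α k ≠ 0)
    (hu : ∀ F, F u = 0 → IsTangentLine (Pair.functional S k f (g k)) F)
    (g' : StrongDual ℝ (Y k)) :
    g' (z.2 k) = (1 - f z.1) * α k * (g' u.2 / g k u.2) := by
  have hgu := h.apply_tangent_snd_ne_zero hf hz hφz hαk hu
  have apply_eq_zero := h.apply_snd_eq_zero hz hφz hαk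
    (hu (Pair.functional S k 0 (g' - (g' u.2 / g k u.2) • g k)) (by
      rw [Pair.functional_apply, zero_apply, zero_add, sub_apply, smul_apply, smul_eq_mul,
        div_mul_cancel₀ _ hgu, sub_self]))
  rw [sub_apply, smul_apply, smul_eq_mul, h.apply_snd_eq hf hz hφz hαk, sub_eq_zero]
    at apply_eq_zero
  rw [apply_eq_zero, mul_comm]

theorem IsRep.hasSum_apply_fst_div (h : S.IsRep φ f g α) (hf : ‖f‖ < 1) (hz : ‖z‖ ≤ 1)
    (hφz : φ z = 1) {u : ∀ k, S.Pair k}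
    (hu : ∀ k F, F (u k) = 0 → IsTangentLine (Pair.functional S k f (g k)) F)
    (f' : StrongDual ℝ X) :
    HasSum (fun k => α k ^ 2 * (f' (u k).1 / g k (u k).2)) (f' z.1 / (1 - f z.1)) := by
  have hsum := (h.hasSum_of_isTangentLine hz hφz (isTangentLine_of_norm_lt_one hf)
    (f' := f') (g' := fun k => -(f' (u k).1 / g k (u k).2) • g k) fun k hαk => hu k _ ?_)
  · rw [← neg_neg (f' z.1), neg_div]
    refine (hsum.div_const (1 - f z.1)).neg.congr_fun fun k => ?_
    by_cases hαk : α k = 0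
    · rw [hαk]; ring
    · have hne := (sub_pos.2 (apply_fst_lt_one hf hz)).ne'
      rw [smul_apply, smul_eq_mul, h.apply_snd_eq hf hz hφz hαk]
      field_simp
  · have hgu := h.apply_tangent_snd_ne_zero hf hz hφz hαk (hu k)
    rw [Pair.functional_apply, smul_apply, smul_eq_mul, neg_mul, div_mul_cancel₀ _ hgu,
      add_neg_cancel]

end LeftNormLtOne

section StrictConvexity

variable [CompleteSpace X] [∀ k, CompleteSpace (Y k)] {z z' : S.Sigma} {c : ℝ}

theorem IsRep.eq_of_norm_lt_one (hsmooth : ∀ k, FrechetSmooth (StrongDual ℝ (S.Pair k)))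
    (hc : 0 < c) (hlower : ∀ k (x : X) (y : Y k), ‖x‖ + c * ‖y‖ ≤ S.nrm k (x, y))
    (h : S.IsRep φ f g α) (hf : ‖f‖ < 1) (hz : ‖z‖ ≤ 1) (hz' : ‖z'‖ ≤ 1) (hφz : φ z = 1)
    (hφz' : φ z' = 1) : z = z' := by
  choose u hu using fun k => (hsmooth k).exists_forall_isTangentLine (h.norm_le k)
  have div_eq (f' : StrongDual ℝ X) : f' z.1 / (1 - f z.1) = f' z'.1 / (1 - f z'.1) :=
    (h.hasSum_apply_fst_div hf hz hφz hu f').unique (h.hasSum_apply_fst_div hf hz' hφz' hu f')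
  have sub_ne : 1 - f z.1 ≠ 0 := (sub_pos.2 (apply_fst_lt_one hf hz)).ne'
  have sub_ne' : 1 - f z'.1 ≠ 0 := (sub_pos.2 (apply_fst_lt_one hf hz')).ne'
  have f_eq : f z.1 = f z'.1 := by
    have := (div_eq_div_iff sub_ne sub_ne').1 (div_eq f)
    linarith
  have fst_eq : z.1 = z'.1 := (SeparatingDual.eq_iff_forall_dual_eq (R := ℝ)).2 fun f' => by
    have := div_eq f'
    rwa [← f_eq, div_left_inj' sub_ne] at this
  have coord_eq (k : ℕ) : z.2 k = z'.2 k := by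
    by_cases hαk : α k = 0
    · rw [h.snd_eq_zero hc hlower hz hφz hαk, h.snd_eq_zero hc hlower hz' hφz' hαk]
    · refine (SeparatingDual.eq_iff_forall_dual_eq (R := ℝ)).2 fun g' => ?_
      rw [h.apply_snd_eq_mul_div hf hz hφz hαk (hu k),
        h.apply_snd_eq_mul_div hf hz' hφz' hαk (hu k), f_eq]
  exact Prod.ext fst_eq (lp.ext (funext coord_eq))

theorem IsRep.eq_of_norm_eq_one (hsmooth : ∀ k, FrechetSmooth (StrongDual ℝ (S.Pair k)))
    (hc : 0 < c) (hlower : ∀ k (x : X) (y : Y k), ‖x‖ + c * ‖y‖ ≤ S.nrm k (x, y))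
    (h : S.IsRep φ f g α) (hf : ‖f‖ = 1) (hz : ‖z‖ ≤ 1) (hz' : ‖z'‖ ≤ 1) (hφz : φ z = 1)
    (hφz' : φ z' = 1) : z = z' := by
  obtain ⟨a, ha⟩ := (frechetSmooth_dual_left (hsmooth 0)).exists_normingFilter_le_nhds
    (norm_ne_zero_iff.1 (hf ▸ one_ne_zero))
  have norm_a_le : ‖a‖ ≤ 1 := norm_le_one_of_normingFilter_le_nhds ha
  have f_apply_a : f a = 1 := (apply_eq_norm_of_normingFilter_le_nhds ha).trans hf
  have hg (k : ℕ) : IsTangentLine (Pair.functional S k f (g k)) (Pair.functional S k 0 (g k)) := by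
    refine (hsmooth k).isTangentLine_of_norming (u := Pair.inl S k a) ?_ ?_ ?_ ?_
    · exact (h.norm_le k).antisymm (hf ▸ Pair.norm_left_le_norm_functional S f (g k))
    · rwa [Pair.norm_inl]
    · rwa [Pair.functional_inl]
    · rw [Pair.functional_inl, zero_apply]
  have eq_norming {w : S.Sigma} (hw : ‖w‖ ≤ 1) (hφw : φ w = 1) : w = Sigma.ofProd S (a, 0) := by
    have hsum :=
      h.hasSum_of_isTangentLine hw hφw (isTangentLine_zero h.norm_left_le) fun k _ => hg k
    have f_apply : f w.1 = 1 := by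
      have := hsum.unique (h.hasSum w)
      rw [zero_apply, neg_zero, hφw] at this
      linarith
    have norm_fst_ge : 1 ≤ ‖w.1‖ := by
      simpa [f_apply] using f.le_of_opNorm_le h.norm_left_le w.1
    have snd_eq : w.2 = 0 := by
      have := norm_fst_add_mul_norm_snd_le hc hlower w
      exact norm_le_zero_iff.1 (nonpos_of_mul_nonpos_right (by linarith) hc)
    refine Prod.ext ?_ snd_eq
    exact eq_of_normingFilter_le_nhds ha ((Sigma.norm_fst_le S w).trans hw) (f_apply.trans hf.symm)
  rw [eq_norming hz hφz, eq_norming hz' hφz']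

theorem strictConvexSpace_sigma (hsmooth : ∀ k, FrechetSmooth (StrongDual ℝ (S.Pair k)))
    (hc : 0 < c) (hlower : ∀ k (x : X) (y : Y k), ‖x‖ + c * ‖y‖ ≤ S.nrm k (x, y)) :
    StrictConvexSpace ℝ S.Sigma := by
  refine StrictConvexSpace.of_norm_add fun z z' hz hz' hadd => ?_
  obtain ⟨φ, f, g, α, h, hφ⟩ := exists_isRep_apply_eq_norm (z + z')
  rw [map_add, hadd] at hφ
  have hφz : φ z = 1 := by linarith [h.apply_le_norm z, h.apply_le_norm z']
  have hφz' : φ z' = 1 := by linarith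
  obtain rfl : z = z' := by
    rcases h.norm_left_le.lt_or_eq with hf | hf
    · exact h.eq_of_norm_lt_one hsmooth hc hlower hf hz.le hz'.le hφz hφz'
    · exact h.eq_of_norm_eq_one hsmooth hc hlower hf hz.le hz'.le hφz hφz'
  exact SameRay.rfl

end StrictConvexity

/-! ### The Kadec–Klee property of the generalized sum -/

section KadecKlee

variable {ι : Type*} {U : Ultrafilter ι} {w : ι → S.Sigma} {z : S.Sigma}

theorem IsRep.tendsto_fst [CompleteSpace X] [∀ k, CompleteSpace (Y k)]
    (hsmooth : ∀ k, FrechetSmooth (StrongDual ℝ (S.Pair k))) (h : S.IsRep φ f g α)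
    (hw : ∀ᶠ i in (U : Filter ι), ‖w i‖ ≤ 1) (hφ : Tendsto (fun i => φ (w i)) U (𝓝 1))
    (hweak : ∀ ψ : StrongDual ℝ S.Sigma, Tendsto (fun i => ψ (w i)) U (𝓝 (ψ z))) :
    Tendsto (fun i => (w i).1) U (𝓝 z.1) := by
  refine tendsto_of_weak_tendsto_of_forall_null (fun f' => hweak (f' ∘L Sigma.fst S)) ?_
  intro f' norm_f'_le f'_tendsto ε hε
  obtain ⟨a, ha⟩ :=
    (frechetSmooth_dual_left (hsmooth 0)).exists_forall_isTangent h.norm_left_le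
  refine h.eventually_apply_fst_le hw hφ (ha (.of_forall norm_f'_le) (f'_tendsto a)) ?_ hε
  intro k _
  obtain ⟨u, hu⟩ := (hsmooth k).exists_forall_isTangent (h.norm_le k)
  refine hu (R := 2) (.of_forall fun i => ?_) ?_
  · rw [Pair.norm_functional_zero_right]
    exact norm_f'_le i
  · simpa only [Pair.functional_apply, zero_apply, add_zero] using f'_tendsto u.1

theorem IsRep.tendsto_coord_of_ne_zero [∀ k, CompleteSpace (S.Pair k)] {k : ℕ}
    (hsmooth : FrechetSmooth (StrongDual ℝ (S.Pair k))) (h : S.IsRep φ f g α)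
    (hw : ∀ᶠ i in (U : Filter ι), ‖w i‖ ≤ 1) (hφ : Tendsto (fun i => φ (w i)) U (𝓝 1))
    (hweak : ∀ ψ : StrongDual ℝ S.Sigma, Tendsto (fun i => ψ (w i)) U (𝓝 (ψ z)))
    (hαk : α k ≠ 0) : Tendsto (fun i => (w i).2 k) U (𝓝 (z.2 k)) := by
  refine tendsto_of_weak_tendsto_of_forall_null (fun g' => hweak (g' ∘L Sigma.coord S k)) ?_
  intro g' norm_g'_le g'_tendsto ε hε
  obtain ⟨u, hu⟩ := hsmooth.exists_forall_isTangent (h.norm_le k)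
  refine h.eventually_apply_snd_le hw hφ hαk (hu (R := 4) (.of_forall fun i => ?_) ?_) hε
  · calc ‖Pair.functional S k 0 (g' i)‖ ≤ ‖(0 : StrongDual ℝ X)‖ + 2 * ‖g' i‖ :=
          Pair.norm_functional_le S 0 (g' i)
      _ ≤ 4 := by rw [norm_zero]; linarith [norm_g'_le i]
  · simpa only [Pair.functional_apply, zero_apply, zero_add] using g'_tendsto u.2

variable {l : Filter ι} {c : ℝ}

theorem IsRep.exists_pos_forall_eventually_sum_norm_sq_le (hc : 0 < c)
    (hlower : ∀ k (x : X) (y : Y k), ‖x‖ + c * ‖y‖ ≤ S.nrm k (x, y)) (h : S.IsRep φ f g α)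
    (hw : ∀ᶠ i in l, ‖w i‖ ≤ 1) (hφ : Tendsto (fun i => φ (w i)) l (𝓝 1)) {ε : ℝ} (hε : 0 < ε) :
    ∃ τ > 0, ∀ᶠ i in l, ∀ t : Finset ℕ, ∑ k ∈ t, α k ^ 2 ≤ τ →
      ∑ k ∈ t, ‖(w i).2 k‖ ^ 2 ≤ ε := by
  let τ := min 1 (c ^ 2 * ε / 48)
  have hτ : 0 < τ := lt_min one_pos (by positivity)
  refine ⟨τ ^ 2, by positivity, ?_⟩
  filter_upwards [hw, hφ.eventually_const_le
    (sub_lt_self 1 (by positivity : 0 < c ^ 2 * ε / 16))] with i hwi hφi t ht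
  have mul_le := h.mul_sum_norm_sq_le hc.le hlower hwi hτ.le ht
  have hτ_one : τ ≤ 1 := min_le_left _ _
  have hτ_le : τ ≤ c ^ 2 * ε / 48 := min_le_right _ _
  refine le_of_mul_le_mul_left ?_ (by positivity : 0 < c ^ 2)
  nlinarith

theorem IsRep.tendsto_coord_of_eq_zero (hc : 0 < c)
    (hlower : ∀ k (x : X) (y : Y k), ‖x‖ + c * ‖y‖ ≤ S.nrm k (x, y)) (h : S.IsRep φ f g α)
    (hw : ∀ᶠ i in l, ‖w i‖ ≤ 1) (hφ : Tendsto (fun i => φ (w i)) l (𝓝 1)) {k : ℕ}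
    (hαk : α k = 0) : Tendsto (fun i => (w i).2 k) l (𝓝 0) := by
  refine nhds_basis_closedBall.tendsto_right_iff.2 fun ε hε => ?_
  obtain ⟨τ, hτ, hev⟩ := h.exists_pos_forall_eventually_sum_norm_sq_le hc hlower hw hφ
    (by positivity : 0 < ε ^ 2)
  filter_upwards [hev] with i hi
  have sq_le := hi {k} (by simpa [hαk] using hτ.le)
  rw [Finset.sum_singleton] at sq_le
  exact mem_closedBall_zero_iff.2 (le_of_sq_le_sq sq_le hε.le)

theorem kadecKlee_sigma [CompleteSpace X] [∀ k, CompleteSpace (Y k)]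
    (hsmooth : ∀ k, FrechetSmooth (StrongDual ℝ (S.Pair k))) (hc : 0 < c)
    (hlower : ∀ k (x : X) (y : Y k), ‖x‖ + c * ‖y‖ ≤ S.nrm k (x, y)) : KadecKlee S.Sigma := by
  intro z hz l hl hweak
  obtain ⟨φ, f, g, α, h, hφz⟩ := exists_isRep_apply_eq_norm z
  refine le_iff_ultrafilter.2 fun U hU => ?_
  have hw : ∀ᶠ w in (U : Filter S.Sigma), ‖w‖ ≤ 1 := by
    filter_upwards [le_principal_iff.1 (hU.trans hl)] with w hw using mem_closedBall_zero_iff.1 hw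
  have hweak_U (ψ : StrongDual ℝ S.Sigma) : Tendsto (fun w => ψ w) U (𝓝 (ψ z)) :=
    (hweak ψ).mono_left hU
  have hφ : Tendsto (fun w => φ w) U (𝓝 1) := by simpa only [hφz, hz] using hweak_U φ
  have fst_tendsto := h.tendsto_fst hsmooth (w := id) hw hφ hweak_U
  have coord_tendsto (k : ℕ) : Tendsto (fun w : S.Sigma => w.2 k) U (𝓝 (z.2 k)) := by
    by_cases hαk : α k = 0
    · rw [h.snd_eq_zero hc hlower hz.le (hφz.trans hz) hαk]
      exact h.tendsto_coord_of_eq_zero hc hlower hw hφ hαk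
    · exact h.tendsto_coord_of_ne_zero (hsmooth k) hw hφ hweak_U hαk
  have snd_tendsto : Tendsto (fun w : S.Sigma => w.2) U (𝓝 z.2) := by
    refine tendsto_lp_of_forall_tendsto_of_tail coord_tendsto fun ε hε => ?_
    obtain ⟨τ, hτ, hev⟩ := h.exists_pos_forall_eventually_sum_norm_sq_le hc hlower hw hφ hε
    obtain ⟨K, hK⟩ := h.weight.exists_finset_sum_sq_le hτ
    exact ⟨K, hev.mono fun w hw t ht => hw t (hK t ht)⟩
  exact (Sigma.ofProd S).continuous.continuousAt.tendsto.comp (fst_tendsto.prodMk_nhds snd_tendsto)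

end KadecKlee

end SumNorms

theorem mainTheorem4
    {X : Type*} [NormedAddCommGroup X] [NormedSpace ℝ X] [CompleteSpace X]
    {Y : ℕ → Type*} [∀ k, NormedAddCommGroup (Y k)] [∀ k, NormedSpace ℝ (Y k)]
    [∀ k, CompleteSpace (Y k)]
    (S : SumNorms X Y)
    (hsmooth : ∀ k, FrechetSmooth (StrongDual ℝ (S.Pair k)))
    (c : ℝ) (hc : 0 < c)
    (hlower : ∀ k (x : X) (y : Y k), ‖x‖ + c * ‖y‖ ≤ S.nrm k (x, y)) :
    FrechetSmooth (StrongDual ℝ S.Sigma) := by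
  have left_reflexive : ReflexiveSpace X := S.reflexiveSpace_left (hsmooth 0)
  have right_reflexive (k : ℕ) : ReflexiveSpace (Y k) := S.reflexiveSpace_right (hsmooth k)
  have : StrictConvexSpace ℝ S.Sigma := SumNorms.strictConvexSpace_sigma hsmooth hc hlower
  exact frechetSmooth_dual_of_reflexiveSpace_of_kadecKlee
    (SumNorms.reflexiveSpace_sigma left_reflexive right_reflexive hc hlower)
    (SumNorms.kadecKlee_sigma hsmooth hc hlower)
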